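/- Let $k$ be an algebraically closed field of characteristic $0$ and let $q \in k$ be non-zero and not a root of unity. Let $\mathcal{O}_q(SL_2)$ be the Hopf algebra over $k$ generated as an algebra by $a,b,c,d$ subject to $$ab = q\,ba,\quad ac = q\,ca,\quad bd = q\,db,\quad cd = q\,dc,\quad bc = cb,\quad ad - q\,bc = 1 = da - q^{-1}bc,$$ with $\Delta(a)=a\otimes a+b\otimes c$, $\Delta(b)=a\otimes b+b\otimes d$, $\Delta(c)=c\otimes a+d\otimes c$, $\Delta(d)=c\otimes b+d\otimes d$, $\varepsilon(a)=\varepsilon(d)=1$, $\varepsilon(b)=\varepsilon(c)=0$, and antipode $S(a)=d$, $S(b)=-q^{-1}b$, $S(c)=-q\,c$, $S(d)=a$. Let $\gamma:\mathcal{O}_q(SL_2)\to k$ be the algebra map with $\gamma(a)=q^{-1}$, $\gamma(b)=\gamma(c)=0$, $\gamma(d)=q$; then $(\mathcal{O}_q(SL_2),S,\gamma)$ is a copivotal coalgebra, that is, $S$ is an anti-coalgebra map, $\gamma\circ S$ is the convolution inverse of $\gamma$, and $S^2(x)=\gamma(x_{(1)})\,x_{(2)}\,\gamma(S(x_{(3)}))$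 for all $x$. For a finite-dimensional right comodule $V$ over a copivotal coalgebra $(C,S,\gamma)$, with coaction $v\mapsto v_{(0)}\otimes v_{(1)}$, the dual space $V^\vee$ is a right $C$-comodule via $\langle f_{(0)},v\rangle f_{(1)}=\langle f,v_{(0)}\rangle S(v_{(1)})$, the comodule map $j_V:V\to V^{\vee\vee}$ is given by $\langle j_V(v),f\rangle=\langle f,v_{(0)}\rangle\gamma(v_{(1)})$, and the Frobenius--Schur indicator is the trace $$\nu(V)=\operatorname{Tr}\bigl(\operatorname{Hom}_C(V,V^\vee)\to\operatorname{Hom}_C(V,V^\vee),\ f\mapsto f^\vee\circ j_V\bigr)\in k .$$ For $\ell\in\tfrac12\mathbb{N}_0=\{0,\tfrac12,1,\dots\}$ let $X_\ell=\operatorname{span}_k\{a^{\ell-i}b^{\ell+i} : i=-\ell,-\ell+1,\dots,\ell\}\subset\mathcal{O}_q(SL_2)$; it is a right coideal, and hence a right $\mathcal{O}_q(SL_2)$-comodule with coaction the restriction of $\Delta$. Then, for every $\ell\in\tfrac12\mathbb{N}_0$, $$\nu(X_\ell)=(-1)^{2\ell}.$$ -/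

import Mathlib

open scoped TensorProduct

noncomputable section

/-- The defining relations of the quantum coordinate algebra of `SL₂`, for four elements of an
arbitrary `k`-algebra. -/
structure QuantumSL2Rel {k : Type*} [Field k] (q : kˣ) {B : Type*} [Ring B] [Algebra k B]
    (a b c d : B) : Prop where
  ab : a * b = (q : k) • (b * a)
  ac : a * c = (q : k) • (c * a)
  bd : b * d = (q : k) • (d * b)
  cd : c * d = (q : k) • (d * c)
  bc : b * c = c * b
  ad : a * d - (q : k) • (b * c) = 1
  da : d * a - (q : k)⁻¹ • (b * c) = 1

/-- Names of the four generators. -/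
inductive OqGen : Type
  | a | b | c | d

/-- The map from the generators with the four given values. -/
def OqGen.elim {B : Type*} (x y z w : B) : OqGen → B
  | .a => x
  | .b => y
  | .c => z
  | .d => w

/-- The defining relations, imposed on the free algebra on four generators. -/
inductive OqRel (k : Type*) [Field k] (q : kˣ) : FreeAlgebra k OqGen → FreeAlgebra k OqGen → Prop
  | ab : OqRel k q (.ι k .a * .ι k .b) ((q : k) • (.ι k .b * .ι k .a))
  | ac : OqRel k q (.ι k .a * .ι k .c) ((q : k) • (.ι k .c * .ι k .a))
  | bd : OqRel k q (.ι k .b * .ι k .d) ((q : k) • (.ι k .d * .ι k .b))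
  | cd : OqRel k q (.ι k .c * .ι k .d) ((q : k) • (.ι k .d * .ι k .c))
  | bc : OqRel k q (.ι k .b * .ι k .c) (.ι k .c * .ι k .b)
  | ad : OqRel k q (.ι k .a * .ι k .d - (q : k) • (.ι k .b * .ι k .c)) 1
  | da : OqRel k q (.ι k .d * .ι k .a - (q : k)⁻¹ • (.ι k .b * .ι k .c)) 1

/-- The quantum coordinate algebra `𝒪_q(SL₂)`: the `k`-algebra presented by the generators
`a, b, c, d` and the relations above. -/
def OqSL2 (k : Type*) [Field k] (q : kˣ) : Type _ := RingQuot (OqRel k q)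

namespace OqSL2

section
variable (k : Type*) [Field k] (q : kˣ)

instance : Ring (OqSL2 k q) := inferInstanceAs (Ring (RingQuot (OqRel k q)))

instance : Algebra k (OqSL2 k q) := inferInstanceAs (Algebra k (RingQuot (OqRel k q)))

/-- The quotient map from the free algebra. -/
def mk : FreeAlgebra k OqGen →ₐ[k] OqSL2 k q := RingQuot.mkAlgHom k (OqRel k q)

theorem mk_rel {x y : FreeAlgebra k OqGen} (h : OqRel k q x y) : mk k q x = mk k q y :=
  RingQuot.mkAlgHom_rel k h

/-- The generator `a`. -/
def a : OqSL2 k q := mk k q (.ι k .a)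
/-- The generator `b`. -/
def b : OqSL2 k q := mk k q (.ι k .b)
/-- The generator `c`. -/
def c : OqSL2 k q := mk k q (.ι k .c)
/-- The generator `d`. -/
def d : OqSL2 k q := mk k q (.ι k .d)

theorem rel : QuantumSL2Rel q (a k q) (b k q) (c k q) (d k q) where
  ab := by simpa [a, b, c, d] using mk_rel k q .ab
  ac := by simpa [a, b, c, d] using mk_rel k q .ac
  bd := by simpa [a, b, c, d] using mk_rel k q .bd
  cd := by simpa [a, b, c, d] using mk_rel k q .cd
  bc := by simpa [a, b, c, d] using mk_rel k q .bc
  ad := by simpa [a, b, c, d] using mk_rel k q .ad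
  da := by simpa [a, b, c, d] using mk_rel k q .da

end

section
variable {k : Type*} [Field k] {q : kˣ} {B : Type*} [Ring B] [Algebra k B]

/-- The universal property of `𝒪_q(SL₂)`: the algebra map with prescribed values on `a, b, c, d`. -/
def lift {x y z w : B} (h : QuantumSL2Rel q x y z w) : OqSL2 k q →ₐ[k] B :=
  RingQuot.liftAlgHom k ⟨FreeAlgebra.lift k (OqGen.elim x y z w), by
    intro u v huv
    induction huv with
    | ab => simpa [OqGen.elim] using h.ab
    | ac => simpa [OqGen.elim] using h.ac
    | bd => simpa [OqGen.elim] using h.bd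
    | cd => simpa [OqGen.elim] using h.cd
    | bc => simpa [OqGen.elim] using h.bc
    | ad => simpa [OqGen.elim] using h.ad
    | da => simpa [OqGen.elim] using h.da⟩

variable {x y z w : B} (h : QuantumSL2Rel q x y z w)

theorem lift_mk (t : FreeAlgebra k OqGen) :
    lift h (mk k q t) = FreeAlgebra.lift k (OqGen.elim x y z w) t :=
  RingQuot.liftAlgHom_mkAlgHom_apply _ _ _ _

@[simp] theorem lift_a : lift h (a k q) = x :=
  (lift_mk h _).trans (by simp [OqGen.elim])
@[simp] theorem lift_b : lift h (b k q) = y :=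
  (lift_mk h _).trans (by simp [OqGen.elim])
@[simp] theorem lift_c : lift h (c k q) = z :=
  (lift_mk h _).trans (by simp [OqGen.elim])
@[simp] theorem lift_d : lift h (d k q) = w :=
  (lift_mk h _).trans (by simp [OqGen.elim])

@[ext] theorem algHom_ext {f g : OqSL2 k q →ₐ[k] B} (ha : f (a k q) = g (a k q))
    (hb : f (b k q) = g (b k q)) (hc : f (c k q) = g (c k q)) (hd : f (d k q) = g (d k q)) :
    f = g := by
  apply RingQuot.ringQuot_ext'
  apply FreeAlgebra.hom_ext
  funext t
  cases t
  · exact ha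
  · exact hb
  · exact hc
  · exact hd

theorem induction {P : OqSL2 k q → Prop} (hs : ∀ r : k, P (algebraMap k _ r))
    (ha : P (a k q)) (hb : P (b k q)) (hc : P (c k q)) (hd : P (d k q))
    (hadd : ∀ u v, P u → P v → P (u + v)) (hmul : ∀ u v, P u → P v → P (u * v))
    (u : OqSL2 k q) : P u := by
  obtain ⟨t, rfl⟩ : ∃ t, mk k q t = u := RingQuot.mkAlgHom_surjective k (OqRel k q) u
  induction t using FreeAlgebra.induction with
  | grade0 r => simpa using hs r
  | grade1 t =>
    cases t
    · exact ha
    · exact hb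
    · exact hc
    · exact hd
  | mul u v hu hv => rw [map_mul]; exact hmul _ _ hu hv
  | add u v hu hv => rw [map_add]; exact hadd _ _ hu hv

end

section
variable (k : Type*) [Field k] (q : kˣ)

theorem rel_comul : QuantumSL2Rel q
    (a k q ⊗ₜ[k] a k q + b k q ⊗ₜ[k] c k q) (a k q ⊗ₜ[k] b k q + b k q ⊗ₜ[k] d k q)
    (c k q ⊗ₜ[k] a k q + d k q ⊗ₜ[k] c k q) (c k q ⊗ₜ[k] b k q + d k q ⊗ₜ[k] d k q) := by
  have h := rel k q
  have hq : (q : k) ≠ 0 := q.ne_zero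
  have had := sub_eq_iff_eq_add.mp h.ad
  have hda := sub_eq_iff_eq_add.mp h.da
  constructor <;>
  · simp only [add_mul, mul_add, Algebra.TensorProduct.tmul_mul_tmul, h.ab, h.ac, h.bd, h.cd,
      ← h.bc, had, hda, TensorProduct.add_tmul, TensorProduct.tmul_add, TensorProduct.tmul_smul,
      ← TensorProduct.smul_tmul', smul_add, Algebra.TensorProduct.one_def]
    match_scalars <;> field_simp <;> ring

theorem rel_diag (r : kˣ) : QuantumSL2Rel q (r : k)⁻¹ (0 : k) (0 : k) (r : k) := by
  constructor <;> simp

open MulOpposite in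
theorem rel_antipode : QuantumSL2Rel q (op (d k q)) (op (-(q : k)⁻¹ • b k q))
    (op (-(q : k) • c k q)) (op (a k q)) := by
  have h := rel k q
  have hq : (q : k) ≠ 0 := q.ne_zero
  have had := sub_eq_iff_eq_add.mp h.ad
  have hda := sub_eq_iff_eq_add.mp h.da
  constructor <;>
  · apply unop_injective
    simp only [unop_mul, unop_op, unop_smul, unop_sub, unop_one, smul_mul_assoc, mul_smul_comm,
      h.ab, h.ac, h.bd, h.cd, ← h.bc, had, hda]
    match_scalars <;> field_simp <;> ring

/-- The algebra map `Δ`. -/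
def comulAlgHom : OqSL2 k q →ₐ[k] OqSL2 k q ⊗[k] OqSL2 k q := lift (rel_comul k q)

/-- The algebra map `ε`, with `ε(a) = ε(d) = 1` and `ε(b) = ε(c) = 0`. -/
def counitAlgHom : OqSL2 k q →ₐ[k] k := lift (x := 1) (y := 0) (z := 0) (w := 1)
  (by constructor <;> simp)

/-- The algebra map `γ`, with `γ(a) = q⁻¹`, `γ(b) = γ(c) = 0` and `γ(d) = q`. -/
def gamma : OqSL2 k q →ₐ[k] k := lift (rel_diag k q q)

/-- The antipode as an algebra map to the opposite algebra:
`S(a) = d`, `S(b) = -q⁻¹ b`, `S(c) = -q c`, `S(d) = a`. -/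
def antipodeAlgHom : OqSL2 k q →ₐ[k] (OqSL2 k q)ᵐᵒᵖ := lift (rel_antipode k q)

instance : Bialgebra k (OqSL2 k q) :=
  Bialgebra.ofAlgHom (comulAlgHom k q) (counitAlgHom k q)
    (by ext <;> simp [comulAlgHom, TensorProduct.tmul_add, TensorProduct.add_tmul] <;> abel)
    (by ext <;> simp [comulAlgHom, counitAlgHom])
    (by ext <;> simp [comulAlgHom, counitAlgHom])

end
end OqSL2

section Comodules

open TensorProduct LinearMap Coalgebra Module

/-- A right comodule over a coalgebra `C`, with coaction `ρ : V → V ⊗ C`. -/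
class RightComodule (k C V : Type*) [Field k] [AddCommGroup C] [Module k C] [Coalgebra k C]
    [AddCommGroup V] [Module k V] where
  /-- The coaction `v ↦ v₍₀₎ ⊗ v₍₁₎`. -/
  coact : V →ₗ[k] V ⊗[k] C
  coact_coassoc : (TensorProduct.assoc k V C C).toLinearMap ∘ₗ coact.rTensor C ∘ₗ coact =
    (comul (R := k) (A := C)).lTensor V ∘ₗ coact
  coact_counit : (counit (R := k) (A := C)).lTensor V ∘ₗ coact = (TensorProduct.mk k V k).flip 1

section Hit

variable {k C : Type*} [Field k] [AddCommGroup C] [Module k C] [Coalgebra k C]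

/-- `hitLeft l c = c₍₁₎ ⟨l, c₍₂₎⟩`. -/
def hitLeft (l : C →ₗ[k] k) : C →ₗ[k] C :=
  (TensorProduct.rid k C).toLinearMap ∘ₗ l.lTensor C ∘ₗ comul

/-- `hitRight l c = ⟨l, c₍₁₎⟩ c₍₂₎`. -/
def hitRight (l : C →ₗ[k] k) : C →ₗ[k] C :=
  (TensorProduct.lid k C).toLinearMap ∘ₗ l.rTensor C ∘ₗ comul

/-- The convolution product `(l ⋆ m)(c) = ⟨l, c₍₁₎⟩ ⟨m, c₍₂₎⟩` on the dual of a coalgebra. -/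
def convProd (l m : C →ₗ[k] k) : C →ₗ[k] k :=
  (TensorProduct.lid k k).toLinearMap ∘ₗ TensorProduct.map l m ∘ₗ comul

theorem hitLeft_hitLeft (l m : C →ₗ[k] k) (c : C) :
    hitLeft l (hitLeft m c) = hitLeft (convProd l m) c := by
  have h1 : ∀ t : C ⊗[k] C, TensorProduct.rid k C (l.lTensor C (comul (R := k)
      (TensorProduct.rid k C (m.lTensor C t)))) =
      TensorProduct.rid k C (((TensorProduct.lid k k).toLinearMap ∘ₗ TensorProduct.map l m).lTensor C
        (TensorProduct.assoc k C C C ((comul (R := k)).rTensor C t))) := by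
    intro t
    induction t with
    | zero => simp
    | add x y hx hy => simp only [map_add, hx, hy]
    | tmul x y =>
      simp only [lTensor_tmul, TensorProduct.rid_tmul, map_smul, rTensor_tmul]
      generalize comul (R := k) x = s
      induction s with
      | zero => simp
      | add u v hu hv => simp only [map_add, smul_add, hu, hv, TensorProduct.add_tmul]
      | tmul u v => simp [smul_smul, mul_comm]
  have h2 := h1 (comul c)
  rw [coassoc_apply] at h2
  refine h2.trans ?_
  rw [← LinearMap.lTensor_comp_apply]
  rfl

theorem hitLeft_hitRight (l m : C →ₗ[k] k) (c : C) :
    hitLeft l (hitRight m c) = hitRight m (hitLeft l c) := by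
  have h1 : ∀ t : C ⊗[k] C, TensorProduct.rid k C (l.lTensor C (comul (R := k)
      (TensorProduct.lid k C (m.rTensor C t)))) =
      TensorProduct.lid k C (TensorProduct.map m ((TensorProduct.rid k C).toLinearMap ∘ₗ l.lTensor C)
        ((comul (R := k)).lTensor C t)) := by
    intro t
    induction t with
    | zero => simp
    | add x y hx hy => simp only [map_add, hx, hy]
    | tmul x y => simp
  have h2 : ∀ t : C ⊗[k] C, TensorProduct.lid k C (m.rTensor C (comul (R := k)
      (TensorProduct.rid k C (l.lTensor C t)))) =
      TensorProduct.lid k C (TensorProduct.map m ((TensorProduct.rid k C).toLinearMap ∘ₗ l.lTensor C)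
        (TensorProduct.assoc k C C C ((comul (R := k)).rTensor C t))) := by
    intro t
    induction t with
    | zero => simp
    | add x y hx hy => simp only [map_add, hx, hy]
    | tmul x y =>
      simp only [lTensor_tmul, TensorProduct.rid_tmul, map_smul, rTensor_tmul]
      generalize comul (R := k) x = s
      induction s with
      | zero => simp
      | add u v hu hv => simp only [map_add, smul_add, hu, hv, TensorProduct.add_tmul]
      | tmul u v => simp [smul_smul]
  have h3 := h1 (comul c)
  have h4 := h2 (comul c)
  rw [coassoc_apply, ← h3] at h4
  exact h4.symm

end Hit

/-- A copivotal coalgebra `(C, S, γ)`: an anti-coalgebra map `S : C → C` and a linear form `γ` such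
that `γ ∘ S` is the convolution inverse of `γ` and
`S²(c) = ⟨γ, c₍₁₎⟩ c₍₂₎ ⟨γ ∘ S, c₍₃₎⟩`. -/
class CopivotalCoalgebra (k C : Type*) [Field k] [AddCommGroup C] [Module k C]
    [Coalgebra k C] where
  /-- The anti-coalgebra map. -/
  S : C →ₗ[k] C
  /-- The linear form. -/
  γ : C →ₗ[k] k
  comul_S : comul ∘ₗ S =
    TensorProduct.map S S ∘ₗ (TensorProduct.comm k C C).toLinearMap ∘ₗ comul
  counit_S : counit ∘ₗ S = counit (R := k)
  conv_left : convProd (γ ∘ₗ S) γ = counit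
  conv_right : convProd γ (γ ∘ₗ S) = counit
  S_sq : S ∘ₗ S = hitLeft (γ ∘ₗ S) ∘ₗ hitRight γ

section Duality

variable (k C : Type*) [Field k] [AddCommGroup C] [Module k C] [Coalgebra k C]

/-- The vector space `Hom_C(V, W)` of comodule maps. -/
def comodHom (V W : Type*) [AddCommGroup V] [Module k V] [RightComodule k C V]
    [AddCommGroup W] [Module k W] [RightComodule k C W] : Submodule k (V →ₗ[k] W) where
  carrier := {f | RightComodule.coact (C := C) ∘ₗ f =
    f.rTensor C ∘ₗ RightComodule.coact (k := k) (C := C) (V := V)}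
  add_mem' := by
    intro f g hf hg
    simp only [Set.mem_ofPred_eq] at *
    rw [LinearMap.comp_add, hf, hg, LinearMap.rTensor_add, LinearMap.add_comp]
  zero_mem' := by simp
  smul_mem' := by
    intro r f hf
    simp only [Set.mem_ofPred_eq] at *
    rw [LinearMap.comp_smul, hf, LinearMap.rTensor_smul, LinearMap.smul_comp]

variable {k C}

theorem comp_mem_comodHom {V W U : Type*} [AddCommGroup V] [Module k V] [RightComodule k C V]
    [AddCommGroup W] [Module k W] [RightComodule k C W]
    [AddCommGroup U] [Module k U] [RightComodule k C U]
    {f : V →ₗ[k] W} {g : W →ₗ[k] U} (hf : f ∈ comodHom k C V W) (hg : g ∈ comodHom k C W U) :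
    g ∘ₗ f ∈ comodHom k C V U := by
  change RightComodule.coact (C := C) ∘ₗ g = g.rTensor C ∘ₗ RightComodule.coact (k := k) (C := C) at hg
  change RightComodule.coact (C := C) ∘ₗ f = f.rTensor C ∘ₗ RightComodule.coact (k := k) (C := C) at hf
  change RightComodule.coact (C := C) ∘ₗ (g ∘ₗ f) = (g ∘ₗ f).rTensor C ∘ₗ RightComodule.coact (k := k) (C := C)
  rw [← LinearMap.comp_assoc, hg, LinearMap.comp_assoc, hf, LinearMap.rTensor_comp,
    LinearMap.comp_assoc]

/-- The left action `l ⇀ v = v₍₀₎ ⟨l, v₍₁₎⟩` of the dual algebra on a right comodule. -/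
def dualAct {V : Type*} [AddCommGroup V] [Module k V] [RightComodule k C V] (l : C →ₗ[k] k) :
    V →ₗ[k] V :=
  (TensorProduct.rid k V).toLinearMap ∘ₗ l.lTensor V ∘ₗ RightComodule.coact

variable [CopivotalCoalgebra k C] {V W : Type*} [AddCommGroup V] [Module k V] [RightComodule k C V]
  [AddCommGroup W] [Module k W] [RightComodule k C W]

open RightComodule CopivotalCoalgebra

/-- For `f` in the dual of `V`, the map `v ↦ ⟨f, v₍₀₎⟩ S(v₍₁₎)`. -/
def dualCoactAux : Dual k V →ₗ[k] V →ₗ[k] C where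
  toFun f := (TensorProduct.lid k C).toLinearMap ∘ₗ TensorProduct.map f S ∘ₗ coact
  map_add' f g := by
    rw [TensorProduct.map_add_left, LinearMap.add_comp, LinearMap.comp_add]
  map_smul' r f := by
    rw [TensorProduct.map_smul_left, LinearMap.smul_comp, LinearMap.comp_smul, RingHom.id_apply]

variable [FiniteDimensional k V] [FiniteDimensional k W]

/-- The coaction on the dual space, determined by
`⟨f₍₀₎, v⟩ f₍₁₎ = ⟨f, v₍₀₎⟩ S(v₍₁₎)`. -/
def dualCoact : Dual k V →ₗ[k] Dual k V ⊗[k] C :=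
  (dualTensorHomEquiv k V C).symm.toLinearMap ∘ₗ dualCoactAux

theorem dualTensorHom_dualCoact (f : Dual k V) :
    dualTensorHom k V C (dualCoact f) = dualCoactAux f :=
  (dualTensorHomEquiv k V C).apply_symm_apply _

theorem dualCoact_spec (f : Dual k V) (v : V) :
    dualTensorHom k V C (dualCoact f) v =
      TensorProduct.lid k C (TensorProduct.map f S (coact (k := k) (C := C) v)) := by
  rw [dualTensorHom_dualCoact]; rfl

/-- The dual comodule. -/
instance dualComodule : RightComodule k C (Dual k V) where
  coact := dualCoact
  coact_coassoc := by
    ext1 f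
    apply (dualTensorHomEquiv k V (C ⊗[k] C)).injective
    ext1 v
    change dualTensorHom k V (C ⊗[k] C) (TensorProduct.assoc k _ C C
      ((dualCoact (C := C)).rTensor C (dualCoact f))) v =
      dualTensorHom k V (C ⊗[k] C) ((comul (R := k) (A := C)).lTensor _ (dualCoact f)) v
    have h1 : ∀ t : Dual k V ⊗[k] C, dualTensorHom k V (C ⊗[k] C) (TensorProduct.assoc k _ C C
        ((dualCoact (C := C)).rTensor C t)) v =
        TensorProduct.comm k C C (TensorProduct.map (dualTensorHom k V C t) S (coact v)) := by
      intro t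
      induction t with
      | zero => simp
      | add x y hx hy =>
        simp only [map_add, LinearMap.add_apply, hx, hy, TensorProduct.map_add_left]
      | tmul f c =>
        have h0 : ∀ s : Dual k V ⊗[k] C, dualTensorHom k V (C ⊗[k] C)
            (TensorProduct.assoc k _ C C (s ⊗ₜ c)) v = dualTensorHom k V C s v ⊗ₜ c := by
          intro s
          induction s with
          | zero => simp
          | add x y hx hy =>
            simp only [map_add, LinearMap.add_apply, hx, hy, TensorProduct.add_tmul]
          | tmul g e => simp [TensorProduct.smul_tmul']
        rw [LinearMap.rTensor_tmul, h0, dualCoact_spec]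
        generalize (coact v : V ⊗[k] C) = s
        induction s with
        | zero => simp
        | add x y hx hy => simp only [map_add, hx, hy, TensorProduct.add_tmul]
        | tmul w e => simp [TensorProduct.smul_tmul']
    have h2 : ∀ t : Dual k V ⊗[k] C, dualTensorHom k V (C ⊗[k] C)
        ((comul (R := k) (A := C)).lTensor _ t) v = comul (R := k) (dualTensorHom k V C t v) := by
      intro t
      induction t with
      | zero => simp
      | add x y hx hy => simp only [map_add, LinearMap.add_apply, hx, hy]
      | tmul g e => simp
    rw [h1, h2, dualTensorHom_dualCoact]
    have h3 : ∀ t : V ⊗[k] C, TensorProduct.map (dualCoactAux f) (S (k := k) (C := C)) t =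
        ((TensorProduct.lid k C).toLinearMap ∘ₗ TensorProduct.map f S).rTensor C
          ((S (k := k) (C := C)).lTensor _ ((coact (k := k) (C := C)).rTensor C t)) := by
      intro t
      induction t with
      | zero => simp
      | add x y hx hy => simp only [map_add, hx, hy]
      | tmul g e => simp [dualCoactAux]
    have hco : (coact (k := k) (C := C)).rTensor C (coact v) =
        (TensorProduct.assoc k V C C).symm ((comul (R := k) (A := C)).lTensor V (coact v)) := by
      rw [LinearEquiv.eq_symm_apply]
      exact LinearMap.congr_fun (coact_coassoc (k := k) (C := C) (V := V)) v
    rw [h3, hco]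
    change _ = comul (R := k) (TensorProduct.lid k C (TensorProduct.map f S (coact v)))
    generalize (coact v : V ⊗[k] C) = s
    induction s with
    | zero => simp
    | add x y hx hy => simp only [map_add, hx, hy]
    | tmul w e =>
      have hS := LinearMap.congr_fun (comul_S (k := k) (C := C)) e
      simp only [LinearMap.comp_apply, LinearEquiv.coe_coe] at hS
      simp only [LinearMap.lTensor_tmul, TensorProduct.map_tmul, TensorProduct.lid_tmul, map_smul,
        hS]
      generalize (comul (R := k) e : C ⊗[k] C) = u
      induction u with
      | zero => simp
      | add x y hx hy => simp only [map_add, TensorProduct.tmul_add, smul_add, hx, hy]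
      | tmul x y => simp [TensorProduct.smul_tmul']
  coact_counit := by
    ext1 f
    apply (dualTensorHomEquiv k V k).injective
    ext1 v
    change dualTensorHom k V k ((counit (R := k) (A := C)).lTensor _ (dualCoact f)) v =
      dualTensorHom k V k (f ⊗ₜ 1) v
    have h2 : ∀ t : Dual k V ⊗[k] C, dualTensorHom k V k
        ((counit (R := k) (A := C)).lTensor _ t) v = counit (R := k) (dualTensorHom k V C t v) := by
      intro t
      induction t with
      | zero => simp
      | add x y hx hy => simp only [map_add, LinearMap.add_apply, hx, hy]
      | tmul g e => simp
    rw [h2, dualCoact_spec]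
    have hS := LinearMap.congr_fun (counit_S (k := k) (C := C))
    simp only [LinearMap.comp_apply] at hS
    have h3 : ∀ t : V ⊗[k] C, counit (R := k) (TensorProduct.lid k C (TensorProduct.map f S t)) =
        f (TensorProduct.rid k V ((counit (R := k) (A := C)).lTensor V t)) := by
      intro t
      induction t with
      | zero => simp
      | add x y hx hy => simp only [map_add, hx, hy]
      | tmul g e => simp [hS, mul_comm]
    have h4 := LinearMap.congr_fun (coact_counit (k := k) (C := C) (V := V)) v
    simp only [LinearMap.comp_apply] at h4
    rw [h3, h4]
    simp

/-- The transpose `⟨f^∨(g), v⟩ = ⟨g, f(v)⟩` of a comodule map is a comodule map. -/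
theorem dualMap_mem_comodHom {f : V →ₗ[k] W} (hf : f ∈ comodHom k C V W) :
    f.dualMap ∈ comodHom k C (Dual k W) (Dual k V) := by
  change coact (C := C) ∘ₗ f.dualMap = f.dualMap.rTensor C ∘ₗ coact (k := k) (C := C)
  ext1 g
  apply (dualTensorHomEquiv k V C).injective
  ext1 v
  change dualTensorHom k V C (dualCoact (f.dualMap g)) v =
    dualTensorHom k V C (f.dualMap.rTensor C (dualCoact g)) v
  have h1 : ∀ t : Dual k W ⊗[k] C, dualTensorHom k V C (f.dualMap.rTensor C t) v =
      dualTensorHom k W C t (f v) := by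
    intro t
    induction t with
    | zero => simp
    | add x y hx hy => simp only [map_add, LinearMap.add_apply, hx, hy]
    | tmul g e => simp
  have h2 : (coact (C := C) (f v) : W ⊗[k] C) = f.rTensor C (coact v) := LinearMap.congr_fun hf v
  rw [h1, dualCoact_spec, dualCoact_spec, h2]
  generalize (coact v : V ⊗[k] C) = s
  induction s with
  | zero => simp
  | add x y hx hy => simp only [map_add, hx, hy]
  | tmul w e => simp

variable (C V) in
/-- The pivotal morphism `⟨j_V(v), f⟩ = ⟨f, γ ⇀ v⟩`. -/
def pivotal : V →ₗ[k] Dual k (Dual k V) :=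
  Dual.eval k V ∘ₗ dualAct (γ (k := k) (C := C))

theorem S_sq_hitLeft (c : C) : S (k := k) (S (k := k) (hitLeft (γ (k := k) (C := C)) c)) =
    hitRight (γ (k := k) (C := C)) c := by
  have h := LinearMap.congr_fun (S_sq (k := k) (C := C)) (hitLeft (γ (k := k) (C := C)) c)
  simp only [LinearMap.comp_apply] at h
  rw [h, hitLeft_hitRight, hitLeft_hitLeft, conv_left]
  simp [hitLeft]

theorem pivotal_mem_comodHom : pivotal C V ∈ comodHom k C V (Dual k (Dual k V)) := by
  change coact (C := C) ∘ₗ pivotal C V = (pivotal C V).rTensor C ∘ₗ coact (k := k) (C := C)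
  ext1 v
  apply (dualTensorHomEquiv k (Dual k V) C).injective
  ext1 g
  change dualTensorHom k (Dual k V) C (dualCoact (pivotal C V v)) g =
    dualTensorHom k (Dual k V) C ((pivotal C V).rTensor C (coact v)) g
  rw [dualCoact_spec]
  have h1 : ∀ t : Dual k V ⊗[k] C, TensorProduct.lid k C (TensorProduct.map (pivotal C V v)
      (S (k := k)) t) = S (k := k) (dualTensorHom k V C t (dualAct (γ (k := k) (C := C)) v)) := by
    intro t
    induction t with
    | zero => simp
    | add x y hx hy => simp only [map_add, LinearMap.add_apply, hx, hy]
    | tmul g e => simp [pivotal]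
  have hco : (coact (k := k) (C := C)).rTensor C (coact v) =
      (TensorProduct.assoc k V C C).symm ((comul (R := k) (A := C)).lTensor V (coact v)) := by
    rw [LinearEquiv.eq_symm_apply]
    exact LinearMap.congr_fun (coact_coassoc (k := k) (C := C) (V := V)) v
  have h2 : ∀ t : V ⊗[k] C, coact (k := k) (C := C)
      (TensorProduct.rid k V ((γ (k := k) (C := C)).lTensor V t)) =
      TensorProduct.rid k _ ((γ (k := k) (C := C)).lTensor (V ⊗[k] C)
        ((coact (k := k) (C := C)).rTensor C t)) := by
    intro t
    induction t with
    | zero => simp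
    | add x y hx hy => simp only [map_add, hx, hy]
    | tmul w e => simp
  have h3 : ∀ t : V ⊗[k] C, TensorProduct.rid k _ ((γ (k := k) (C := C)).lTensor (V ⊗[k] C)
      ((TensorProduct.assoc k V C C).symm ((comul (R := k) (A := C)).lTensor V t))) =
      (hitLeft (γ (k := k) (C := C))).lTensor V t := by
    intro t
    induction t with
    | zero => simp
    | add x y hx hy => simp only [map_add, hx, hy]
    | tmul w e =>
      simp only [LinearMap.lTensor_tmul, hitLeft, LinearMap.comp_apply, LinearEquiv.coe_coe]
      generalize (comul (R := k) e : C ⊗[k] C) = u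
      induction u with
      | zero => simp
      | add x y hx hy => simp only [map_add, TensorProduct.tmul_add, hx, hy]
      | tmul x y => simp
  have h4 : ∀ t : V ⊗[k] C, dualTensorHom k (Dual k V) C ((pivotal C V).rTensor C t) g =
      TensorProduct.lid k C (TensorProduct.map g
        ((TensorProduct.lid k C).toLinearMap ∘ₗ (γ (k := k) (C := C)).rTensor C)
        (TensorProduct.assoc k V C C ((coact (k := k) (C := C)).rTensor C t))) := by
    intro t
    induction t with
    | zero => simp
    | add x y hx hy => simp only [map_add, LinearMap.add_apply, hx, hy]
    | tmul w e =>
      simp only [LinearMap.rTensor_tmul, dualTensorHom_apply, pivotal, LinearMap.comp_apply,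
        Dual.eval_apply, dualAct, LinearEquiv.coe_coe]
      generalize (coact w : V ⊗[k] C) = u
      induction u with
      | zero => simp
      | add x y hx hy => simp only [map_add, TensorProduct.add_tmul, add_smul, hx, hy]
      | tmul x y => simp [smul_smul]
  have h5 : coact (k := k) (C := C) (dualAct (γ (k := k) (C := C)) v) =
      (hitLeft (γ (k := k) (C := C))).lTensor V (coact v) := by
    refine (h2 _).trans ?_
    rw [hco, h3]
  refine (h1 _).trans ?_
  change S (k := k) (dualTensorHom k V C (dualCoact g) (dualAct (γ (k := k) (C := C)) v)) = _
  rw [dualCoact_spec, h5, h4, hco, LinearEquiv.apply_symm_apply]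
  generalize (coact v : V ⊗[k] C) = s
  induction s with
  | zero => simp
  | add x y hx hy => simp only [map_add, hx, hy]
  | tmul w e =>
    simp only [LinearMap.lTensor_tmul, TensorProduct.map_tmul, TensorProduct.lid_tmul, map_smul,
      S_sq_hitLeft]
    rfl

variable (k C V W)

/-- The transposition map `Hom_C(V, W^∨) → Hom_C(W, V^∨)`, `f ↦ f^∨ ∘ j_W`. -/
def transposition : comodHom k C V (Dual k W) →ₗ[k] comodHom k C W (Dual k V) where
  toFun f := ⟨f.1.dualMap ∘ₗ pivotal C W,
    comp_mem_comodHom pivotal_mem_comodHom (dualMap_mem_comodHom f.2)⟩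
  map_add' f g := by ext; simp
  map_smul' r f := by ext; simp

/-- The Frobenius--Schur indicator `ν(V)` of a finite-dimensional right comodule `V` over a
copivotal coalgebra: the trace of the transposition map on `Hom_C(V, V^∨)`. -/
def fsIndicator : k := LinearMap.trace k (comodHom k C V (Dual k V)) (transposition k C V V)

end Duality

section Subcomodule

variable {k C V : Type*} [Field k] [AddCommGroup C] [Module k C] [Coalgebra k C]
  [AddCommGroup V] [Module k V] [RightComodule k C V]

open RightComodule

/-- Restriction of the coaction to a subspace `W` with `ρ(W) ⊆ W ⊗ C`. -/
def subCoact (W : Submodule k V)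
    (hW : ∀ w ∈ W, coact (k := k) (C := C) w ∈ LinearMap.range (W.subtype.rTensor C)) :
    W →ₗ[k] W ⊗[k] C :=
  (LinearEquiv.ofInjective (W.subtype.rTensor C)
    (Module.Flat.rTensor_preserves_injective_linearMap _ W.injective_subtype)).symm.toLinearMap ∘ₗ
    LinearMap.codRestrict _ (coact ∘ₗ W.subtype) (fun w => hW w w.2)

theorem subCoact_spec (W : Submodule k V)
    (hW : ∀ w ∈ W, coact (k := k) (C := C) w ∈ LinearMap.range (W.subtype.rTensor C)) (w : W) :
    W.subtype.rTensor C (subCoact W hW w) = coact (w : V) := by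
  have := LinearEquiv.apply_symm_apply (LinearEquiv.ofInjective (W.subtype.rTensor C)
    (Module.Flat.rTensor_preserves_injective_linearMap _ W.injective_subtype))
    (LinearMap.codRestrict _ (coact ∘ₗ W.subtype) (fun w => hW w w.2) w)
  exact congrArg Subtype.val this

/-- A subspace `W` with `ρ(W) ⊆ W ⊗ C` is a right comodule with the restricted coaction. -/
abbrev subComodule (W : Submodule k V)
    (hW : ∀ w ∈ W, coact (k := k) (C := C) w ∈ LinearMap.range (W.subtype.rTensor C)) :
    RightComodule k C W where
  coact := subCoact W hW
  coact_coassoc := by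
    ext1 w
    apply Module.Flat.rTensor_preserves_injective_linearMap (M := C ⊗[k] C) _ W.injective_subtype
    simp only [LinearMap.comp_apply, LinearEquiv.coe_coe]
    have h1 : ∀ t : W ⊗[k] C, W.subtype.rTensor (C ⊗[k] C) (TensorProduct.assoc k W C C
        ((subCoact W hW).rTensor C t)) = TensorProduct.assoc k V C C
        ((coact (k := k) (C := C)).rTensor C (W.subtype.rTensor C t)) := by
      intro t
      induction t with
      | zero => simp
      | add x y hx hy => simp only [map_add, hx, hy]
      | tmul w e =>
        simp only [LinearMap.rTensor_tmul, Submodule.subtype_apply]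
        rw [← subCoact_spec W hW w]
        generalize subCoact W hW w = u
        induction u with
        | zero => simp
        | add x y hx hy => simp only [map_add, TensorProduct.add_tmul, hx, hy]
        | tmul x y => simp
    have h2 : ∀ t : W ⊗[k] C, W.subtype.rTensor (C ⊗[k] C)
        ((comul (R := k) (A := C)).lTensor W t) =
        (comul (R := k) (A := C)).lTensor V (W.subtype.rTensor C t) := by
      intro t
      induction t with
      | zero => simp
      | add x y hx hy => simp only [map_add, hx, hy]
      | tmul w e => simp
    rw [h1, h2, subCoact_spec]
    exact LinearMap.congr_fun (coact_coassoc (k := k) (C := C) (V := V)) w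
  coact_counit := by
    ext1 w
    apply Module.Flat.rTensor_preserves_injective_linearMap (M := k) _ W.injective_subtype
    simp only [LinearMap.comp_apply]
    have h2 : ∀ t : W ⊗[k] C, W.subtype.rTensor k
        ((counit (R := k) (A := C)).lTensor W t) =
        (counit (R := k) (A := C)).lTensor V (W.subtype.rTensor C t) := by
      intro t
      induction t with
      | zero => simp
      | add x y hx hy => simp only [map_add, hx, hy]
      | tmul w e => simp
    rw [h2, subCoact_spec]
    exact LinearMap.congr_fun (coact_counit (k := k) (C := C) (V := V)) w

/-- A coalgebra is a right comodule over itself via its comultiplication. -/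
instance regularComodule : RightComodule k C C where
  coact := comul
  coact_coassoc := coassoc
  coact_counit := lTensor_counit_comp_comul

end Subcomodule
end Comodules

namespace OqSL2

open TensorProduct LinearMap Coalgebra

section
variable (k : Type*) [Field k] (q : kˣ)

theorem comul_eq (u : OqSL2 k q) : comul (R := k) u = comulAlgHom k q u := rfl
theorem counit_eq (u : OqSL2 k q) : counit (R := k) u = counitAlgHom k q u := rfl

@[simp] theorem comul_a : comul (R := k) (a k q) = a k q ⊗ₜ a k q + b k q ⊗ₜ c k q := lift_a _
@[simp] theorem comul_b : comul (R := k) (b k q) = a k q ⊗ₜ b k q + b k q ⊗ₜ d k q := lift_b _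
@[simp] theorem comul_c : comul (R := k) (c k q) = c k q ⊗ₜ a k q + d k q ⊗ₜ c k q := lift_c _
@[simp] theorem comul_d : comul (R := k) (d k q) = c k q ⊗ₜ b k q + d k q ⊗ₜ d k q := lift_d _
@[simp] theorem counit_a : counit (R := k) (a k q) = 1 := lift_a _
@[simp] theorem counit_b : counit (R := k) (b k q) = 0 := lift_b _
@[simp] theorem counit_c : counit (R := k) (c k q) = 0 := lift_c _
@[simp] theorem counit_d : counit (R := k) (d k q) = 1 := lift_d _

/-- The antipode as a linear map. -/
def antipodeLin : OqSL2 k q →ₗ[k] OqSL2 k q :=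
  (MulOpposite.opLinearEquiv k).symm.toLinearMap ∘ₗ (antipodeAlgHom k q).toLinearMap

theorem antipodeLin_mul (u v : OqSL2 k q) :
    antipodeLin k q (u * v) = antipodeLin k q v * antipodeLin k q u := by
  simp [antipodeLin]

theorem antipodeLin_algebraMap (r : k) :
    antipodeLin k q (algebraMap k _ r) = algebraMap k _ r := by
  simp [antipodeLin]

@[simp] theorem antipodeLin_a : antipodeLin k q (a k q) = d k q := by
  simp [antipodeLin, antipodeAlgHom]
@[simp] theorem antipodeLin_b : antipodeLin k q (b k q) = -(q : k)⁻¹ • b k q := by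
  simp [antipodeLin, antipodeAlgHom]
@[simp] theorem antipodeLin_c : antipodeLin k q (c k q) = -(q : k) • c k q := by
  simp [antipodeLin, antipodeAlgHom]
@[simp] theorem antipodeLin_d : antipodeLin k q (d k q) = a k q := by
  simp [antipodeLin, antipodeAlgHom]

theorem antipode_left (u : OqSL2 k q) :
    LinearMap.mul' k _ ((antipodeLin k q).rTensor _ (comul u)) =
      algebraMap k _ (counit (R := k) u) := by
  have h := rel k q
  have hq : (q : k) ≠ 0 := q.ne_zero
  have had := sub_eq_iff_eq_add.mp h.ad
  have hda := sub_eq_iff_eq_add.mp h.da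
  have key : ∀ s t : OqSL2 k q ⊗[k] OqSL2 k q, ∀ r : k,
      LinearMap.mul' k _ ((antipodeLin k q).rTensor _ s) = algebraMap k _ r →
      LinearMap.mul' k _ ((antipodeLin k q).rTensor _ (s * t)) =
        r • LinearMap.mul' k _ ((antipodeLin k q).rTensor _ t) := by
    intro s t r hs
    induction t with
    | zero => simp
    | add x y hx hy => simp only [mul_add, map_add, smul_add, hx, hy]
    | tmul x y =>
      have h1 : LinearMap.mul' k _ ((antipodeLin k q).rTensor _ (s * (x ⊗ₜ y))) =
          antipodeLin k q x * LinearMap.mul' k _ ((antipodeLin k q).rTensor _ s) * y := by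
        clear hs
        induction s with
        | zero => simp
        | add u v hu hv => simp only [add_mul, map_add, mul_add, hu, hv]
        | tmul u v => simp [antipodeLin_mul, mul_assoc]
      rw [h1, hs, ← Algebra.commutes, mul_assoc, ← Algebra.smul_def]
      simp
  induction u using OqSL2.induction with
  | hs r => simp [Algebra.algebraMap_eq_smul_one, antipodeLin, Algebra.TensorProduct.one_def]
  | ha => simp [hda]
  | hb => simp [h.bd, hq]
  | hc => simp [h.ac]
  | hd => simp [had, ← h.bc]
  | hadd u v hu hv => simp only [map_add, hu, hv]
  | hmul u v hu hv =>
    rw [Bialgebra.comul_mul, key _ _ _ hu, hv, Bialgebra.counit_mul, map_mul, Algebra.smul_def]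

theorem antipode_right (u : OqSL2 k q) :
    LinearMap.mul' k _ ((antipodeLin k q).lTensor _ (comul u)) =
      algebraMap k _ (counit (R := k) u) := by
  have h := rel k q
  have hq : (q : k) ≠ 0 := q.ne_zero
  have had := sub_eq_iff_eq_add.mp h.ad
  have hda := sub_eq_iff_eq_add.mp h.da
  have key : ∀ s t : OqSL2 k q ⊗[k] OqSL2 k q, ∀ r : k,
      LinearMap.mul' k _ ((antipodeLin k q).lTensor _ t) = algebraMap k _ r →
      LinearMap.mul' k _ ((antipodeLin k q).lTensor _ (s * t)) =
        r • LinearMap.mul' k _ ((antipodeLin k q).lTensor _ s) := by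
    intro s t r ht
    induction s with
    | zero => simp
    | add x y hx hy => simp only [add_mul, map_add, smul_add, hx, hy]
    | tmul x y =>
      have h1 : LinearMap.mul' k _ ((antipodeLin k q).lTensor _ ((x ⊗ₜ y) * t)) =
          x * LinearMap.mul' k _ ((antipodeLin k q).lTensor _ t) * antipodeLin k q y := by
        clear ht
        induction t with
        | zero => simp
        | add u v hu hv => simp only [add_mul, map_add, mul_add, hu, hv]
        | tmul u v => simp [antipodeLin_mul, mul_assoc]
      rw [h1, ht, ← Algebra.commutes, mul_assoc, ← Algebra.smul_def]
      simp
  induction u using OqSL2.induction with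
  | hs r => simp [Algebra.algebraMap_eq_smul_one, antipodeLin, Algebra.TensorProduct.one_def]
  | ha => simp [had]
  | hb => simp [h.ab]
  | hc => simp [h.cd]
  | hd => simp [hda, ← h.bc]
  | hadd u v hu hv => simp only [map_add, hu, hv]
  | hmul u v hu hv =>
    rw [Bialgebra.comul_mul, key _ _ _ hv, hu, Bialgebra.counit_mul, map_mul, Algebra.smul_def,
      Algebra.commutes]

instance : HopfAlgebra k (OqSL2 k q) where
  antipode := antipodeLin k q
  mul_antipode_rTensor_comul := LinearMap.ext (antipode_left k q)
  mul_antipode_lTensor_comul := LinearMap.ext (antipode_right k q)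

theorem comul_antipodeLin (u : OqSL2 k q) : comul (R := k) (antipodeLin k q u) =
    TensorProduct.map (antipodeLin k q) (antipodeLin k q) (TensorProduct.comm k _ _ (comul u)) := by
  have key : ∀ s t : OqSL2 k q ⊗[k] OqSL2 k q,
      TensorProduct.map (antipodeLin k q) (antipodeLin k q) (TensorProduct.comm k _ _ (s * t)) =
      TensorProduct.map (antipodeLin k q) (antipodeLin k q) (TensorProduct.comm k _ _ t) *
      TensorProduct.map (antipodeLin k q) (antipodeLin k q) (TensorProduct.comm k _ _ s) := by
    intro s t
    induction s with
    | zero => simp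
    | add x y hx hy => simp only [add_mul, map_add, mul_add, hx, hy]
    | tmul x y =>
      induction t with
      | zero => simp
      | add x y hx hy => simp only [add_mul, map_add, mul_add, hx, hy]
      | tmul u v => simp [antipodeLin_mul]
  have hq : (q : k) ≠ 0 := q.ne_zero
  induction u using OqSL2.induction with
  | hs r => simp [Algebra.algebraMap_eq_smul_one, antipodeLin, Algebra.TensorProduct.one_def]
  | ha =>
    simp [TensorProduct.tmul_smul, ← TensorProduct.smul_tmul', TensorProduct.neg_tmul,
      TensorProduct.tmul_neg]
    match_scalars <;> field_simp
  | hb =>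
    simp [TensorProduct.tmul_smul, ← TensorProduct.smul_tmul', TensorProduct.neg_tmul,
      TensorProduct.tmul_neg]
  | hc =>
    simp [TensorProduct.tmul_smul, ← TensorProduct.smul_tmul', TensorProduct.neg_tmul,
      TensorProduct.tmul_neg]
  | hd =>
    simp [TensorProduct.tmul_smul, ← TensorProduct.smul_tmul', TensorProduct.neg_tmul,
      TensorProduct.tmul_neg]
    match_scalars <;> field_simp
  | hadd u v hu hv => simp only [map_add, hu, hv]
  | hmul u v hu hv =>
    rw [antipodeLin_mul, Bialgebra.comul_mul, hu, hv, Bialgebra.comul_mul, key]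

@[simp] theorem gamma_a : gamma k q (a k q) = (q : k)⁻¹ := lift_a _
@[simp] theorem gamma_b : gamma k q (b k q) = 0 := lift_b _
@[simp] theorem gamma_c : gamma k q (c k q) = 0 := lift_c _
@[simp] theorem gamma_d : gamma k q (d k q) = q := lift_d _

theorem hitRight_mul (f : OqSL2 k q →ₐ[k] k) (u v : OqSL2 k q) :
    hitRight f.toLinearMap (u * v) = hitRight f.toLinearMap u * hitRight f.toLinearMap v := by
  have key : ∀ s t : OqSL2 k q ⊗[k] OqSL2 k q,
      TensorProduct.lid k _ (f.toLinearMap.rTensor _ (s * t)) =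
      TensorProduct.lid k _ (f.toLinearMap.rTensor _ s) *
      TensorProduct.lid k _ (f.toLinearMap.rTensor _ t) := by
    intro s t
    induction s with
    | zero => simp
    | add x y hx hy => simp only [add_mul, map_add, hx, hy]
    | tmul x y =>
      induction t with
      | zero => simp
      | add x y hx hy => simp only [map_add, mul_add, hx, hy]
      | tmul u v => simp [smul_smul, mul_comm]
  simp only [hitRight, LinearMap.comp_apply, LinearEquiv.coe_coe, Bialgebra.comul_mul, key]

theorem hitLeft_mul (f : OqSL2 k q →ₐ[k] k) (u v : OqSL2 k q) :
    hitLeft f.toLinearMap (u * v) = hitLeft f.toLinearMap u * hitLeft f.toLinearMap v := by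
  have key : ∀ s t : OqSL2 k q ⊗[k] OqSL2 k q,
      TensorProduct.rid k _ (f.toLinearMap.lTensor _ (s * t)) =
      TensorProduct.rid k _ (f.toLinearMap.lTensor _ s) *
      TensorProduct.rid k _ (f.toLinearMap.lTensor _ t) := by
    intro s t
    induction s with
    | zero => simp
    | add x y hx hy => simp only [add_mul, map_add, hx, hy]
    | tmul x y =>
      induction t with
      | zero => simp
      | add x y hx hy => simp only [map_add, mul_add, hx, hy]
      | tmul u v => simp [smul_smul, mul_comm]
  simp only [hitLeft, LinearMap.comp_apply, LinearEquiv.coe_coe, Bialgebra.comul_mul, key]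

theorem gamma_comp_antipodeLin : (gamma k q).toLinearMap ∘ₗ antipodeLin k q =
    (lift (rel_diag k q q⁻¹)).toLinearMap := by
  ext1 u
  simp only [LinearMap.comp_apply, AlgHom.toLinearMap_apply]
  induction u using OqSL2.induction with
  | hs r => simp [antipodeLin_algebraMap]
  | ha => simp
  | hb => simp
  | hc => simp
  | hd => simp
  | hadd u v hu hv => simp only [map_add, hu, hv]
  | hmul u v hu hv => rw [antipodeLin_mul, map_mul, map_mul, hu, hv, mul_comm]

/-- The copivotal structure on `𝒪_q(SL₂)` given by the antipode and `γ`. -/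
instance copivotal : CopivotalCoalgebra k (OqSL2 k q) where
  S := HopfAlgebra.antipode k
  γ := (gamma k q).toLinearMap
  comul_S := LinearMap.ext (comul_antipodeLin k q)
  counit_S := HopfAlgebra.counit_comp_antipode
  conv_left := by
    ext1 u
    have h : ∀ s : OqSL2 k q ⊗[k] OqSL2 k q, TensorProduct.lid k k
        (TensorProduct.map ((gamma k q).toLinearMap ∘ₗ antipodeLin k q) (gamma k q).toLinearMap s) =
        gamma k q (LinearMap.mul' k _ ((antipodeLin k q).rTensor _ s)) := by
      intro s
      induction s with
      | zero => simp
      | add x y hx hy => simp only [map_add, hx, hy]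
      | tmul x y => simp
    refine (h _).trans ?_
    rw [antipode_left]
    simp
  conv_right := by
    ext1 u
    have h : ∀ s : OqSL2 k q ⊗[k] OqSL2 k q, TensorProduct.lid k k
        (TensorProduct.map (gamma k q).toLinearMap ((gamma k q).toLinearMap ∘ₗ antipodeLin k q) s) =
        gamma k q (LinearMap.mul' k _ ((antipodeLin k q).lTensor _ s)) := by
      intro s
      induction s with
      | zero => simp
      | add x y hx hy => simp only [map_add, hx, hy]
      | tmul x y => simp
    refine (h _).trans ?_
    rw [antipode_right]
    simp
  S_sq := by
    change antipodeLin k q ∘ₗ antipodeLin k q =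
      hitLeft ((gamma k q).toLinearMap ∘ₗ antipodeLin k q) ∘ₗ hitRight (gamma k q).toLinearMap
    have hq : (q : k) ≠ 0 := q.ne_zero
    rw [gamma_comp_antipodeLin]
    ext1 u
    simp only [LinearMap.comp_apply]
    induction u using OqSL2.induction with
    | hs r =>
      rw [antipodeLin_algebraMap, antipodeLin_algebraMap]
      simp [hitLeft, hitRight, Algebra.algebraMap_eq_smul_one, Algebra.TensorProduct.one_def]
    | ha => simp [hitLeft, hitRight, smul_smul, hq]
    | hb => simp [hitLeft, hitRight, smul_smul]
    | hc => simp [hitLeft, hitRight, smul_smul]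
    | hd => simp [hitLeft, hitRight, smul_smul, hq]
    | hadd u v hu hv => simp only [map_add, hu, hv]
    | hmul u v hu hv =>
      rw [antipodeLin_mul, antipodeLin_mul, hu, hv, hitRight_mul, hitLeft_mul]

/-- The subspace `X_ℓ = span {a ^ (ℓ - i) b ^ (ℓ + i) | i = -ℓ, -ℓ + 1, …, ℓ}` of `𝒪_q(SL₂)`, where
`n = 2 ℓ`. -/
def X (n : ℕ) : Submodule k (OqSL2 k q) :=
  Submodule.span k (Set.range fun i : Fin (n + 1) => a k q ^ (n - (i : ℕ)) * b k q ^ (i : ℕ))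

instance (n : ℕ) : FiniteDimensional k (X k q n) :=
  FiniteDimensional.span_of_finite k (Set.finite_range _)

theorem mem_X (r s : ℕ) : a k q ^ r * b k q ^ s ∈ X k q (r + s) :=
  Submodule.subset_span ⟨⟨s, by omega⟩, by simp⟩

theorem a_mul_mem {n : ℕ} {x : OqSL2 k q} (hx : x ∈ X k q n) : a k q * x ∈ X k q (n + 1) := by
  induction hx using Submodule.span_induction with
  | zero => simp
  | add x y _ _ hx hy => rw [mul_add]; exact add_mem hx hy
  | smul r x _ hx => rw [mul_smul_comm]; exact Submodule.smul_mem _ _ hx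
  | mem x hx =>
    obtain ⟨i, rfl⟩ := hx
    have := mem_X k q (n - i + 1) i
    rw [show n - (i : ℕ) + 1 + i = n + 1 by omega] at this
    simpa [pow_succ', mul_assoc] using this

theorem b_mul_mem {n : ℕ} {x : OqSL2 k q} (hx : x ∈ X k q n) : b k q * x ∈ X k q (n + 1) := by
  have hq : (q : k) ≠ 0 := q.ne_zero
  have hba : b k q * a k q = (q : k)⁻¹ • (a k q * b k q) := by
    rw [(rel k q).ab, smul_smul, inv_mul_cancel₀ hq, one_smul]
  have hbp : ∀ r : ℕ, b k q * a k q ^ r = (q : k)⁻¹ ^ r • (a k q ^ r * b k q) := by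
    intro r
    induction r with
    | zero => simp
    | succ r ih =>
      rw [pow_succ, ← mul_assoc, ih, smul_mul_assoc, mul_assoc, hba, mul_smul_comm, smul_smul,
        ← pow_succ, mul_assoc]
  induction hx using Submodule.span_induction with
  | zero => simp
  | add x y _ _ hx hy => rw [mul_add]; exact add_mem hx hy
  | smul r x _ hx => rw [mul_smul_comm]; exact Submodule.smul_mem _ _ hx
  | mem x hx =>
    obtain ⟨i, rfl⟩ := hx
    have := mem_X k q (n - i) (i + 1)
    rw [show n - (i : ℕ) + (i + 1) = n + 1 by omega] at this
    simp only [← mul_assoc, hbp, smul_mul_assoc]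
    rw [mul_assoc, ← pow_succ']
    exact Submodule.smul_mem _ _ this

/-- `X_ℓ` is a right coideal. -/
theorem X_coideal (n : ℕ) : ∀ w ∈ X k q n, RightComodule.coact (k := k) (C := OqSL2 k q) w ∈
    LinearMap.range ((X k q n).subtype.rTensor (OqSL2 k q)) := by
  have step : ∀ (n : ℕ) (u v : OqSL2 k q),
      ∀ t ∈ LinearMap.range ((X k q n).subtype.rTensor (OqSL2 k q)),
      (a k q ⊗ₜ[k] u + b k q ⊗ₜ[k] v) * t ∈
        LinearMap.range ((X k q (n + 1)).subtype.rTensor (OqSL2 k q)) := by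
    rintro n u v _ ⟨t, rfl⟩
    induction t with
    | zero => simp
    | add x y hx hy => rw [map_add, mul_add]; exact add_mem hx hy
    | tmul x y =>
      refine ⟨(⟨_, a_mul_mem k q x.2⟩ : X k q (n + 1)) ⊗ₜ (u * y) +
        (⟨_, b_mul_mem k q x.2⟩ : X k q (n + 1)) ⊗ₜ (v * y), ?_⟩
      simp [add_mul]
  have mon : ∀ r s : ℕ, comul (R := k) (a k q ^ r * b k q ^ s) ∈
      LinearMap.range ((X k q (r + s)).subtype.rTensor (OqSL2 k q)) := by
    intro r s
    induction r with
    | zero =>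
      rw [zero_add, pow_zero, one_mul]
      induction s with
      | zero =>
        have h1 := mem_X k q 0 0
        simp only [pow_zero, mul_one] at h1
        exact ⟨(⟨1, h1⟩ : X k q 0) ⊗ₜ 1, by simp [Algebra.TensorProduct.one_def]⟩
      | succ s ih =>
        rw [pow_succ', Bialgebra.comul_mul, comul_b]
        exact step _ _ _ _ ih
    | succ r ih =>
      rw [pow_succ', mul_assoc, Bialgebra.comul_mul, comul_a, show r + 1 + s = r + s + 1 by omega]
      exact step _ _ _ _ ih
  intro w hw
  change comul (R := k) w ∈ _
  induction hw using Submodule.span_induction with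
  | zero => simp
  | add x y _ _ hx hy => rw [map_add]; exact add_mem hx hy
  | smul r x _ hx => rw [map_smul]; exact Submodule.smul_mem _ _ hx
  | mem x hx =>
    obtain ⟨i, rfl⟩ := hx
    have := mon (n - i) i
    rwa [show n - (i : ℕ) + i = n by omega] at this

/-- `X_ℓ` is a right comodule, the coaction being the restriction of `Δ`. -/
instance XComodule (n : ℕ) : RightComodule k (OqSL2 k q) (X k q n) :=
  subComodule (X k q n) (X_coideal k q n)

end
end OqSL2
end

/-!
View a comodule map `f : X_ℓ → X_ℓ^∨` as a bilinear form. Being a comodule map means the invariance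
identity `⟨f(v₍₀₎), w⟩ v₍₁₎ = ⟨f(v), w₍₀₎⟩ S(w₍₁₎)` (`coeffMap_eq_of_mem_comodHom`). With `n = 2ℓ`, it
suffices to use this identity at the extreme weight vectors `a ^ n` and `b ^ n` of `X_ℓ`, whose
coproducts are given by the quantum binomial theorem (`add_pow_of_quantum_commute`) with nonzero
coefficients, `q` not being a root of unity.

* At `(a ^ n, b ^ n)` it equates a combination of the `a ^ (n - i) * c ^ i` with a combination of the
  `a ^ i * b ^ (n - i)`. Only `a ^ n` is common to both families, which forces `f` to be determined by
  the scalar `⟨f(a ^ n), b ^ n⟩` (`eq_zero_of_apply_zero_last`). So the space of such `f` is at most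
  one-dimensional.
* The map `g ↦ ⟨g, w₍₀₎⟩ S(w₍₁₎)` with `w = b ^ n` is an isomorphism of comodules from `X_ℓ^∨` onto
  `X_ℓ`, and its inverse is a nonzero `f` (`exists_comodHom_dual_ne_zero`). So the dimension is one.
* At `(a ^ n, a ^ n)`, comparing the terms in `c ^ n` gives
  `⟨f(b ^ n), a ^ n⟩ = (-q) ^ n ⟨f(a ^ n), b ^ n⟩` (`apply_last_zero`). The transpose of `f` takes the
  value `⟨f(b ^ n), γ ⇀ a ^ n⟩ = q⁻¹ ^ n ⟨f(b ^ n), a ^ n⟩` at `(a ^ n, b ^ n)`, so transposition is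
  multiplication by `(-1) ^ n` (`transposition_eq`), and this is also its trace.

The linear independence of monomials that is needed comes from the two quotients of `𝒪_q(SL₂)` by `c`
and by `b`, each acting on functions on `ℤ` by scaling and translation (`upperCoeff`, `lowerCoeff`).
-/

noncomputable section

section

open TensorProduct LinearMap Coalgebra Module

/-! ### The quantum binomial theorem -/

section QuantumBinomial

variable {k : Type*} [Field k] (P : k)

/-- The unnormalised quantum factorial `(1 - P) (1 - P ^ 2) ⋯ (1 - P ^ n)`. -/
def quantumFactorial (n : ℕ) : k := ∏ i ∈ Finset.range n, (1 - P ^ (i + 1))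

theorem quantumFactorial_zero : quantumFactorial P 0 = 1 := Finset.prod_range_zero _

theorem quantumFactorial_succ (n : ℕ) :
    quantumFactorial P (n + 1) = quantumFactorial P n * (1 - P ^ (n + 1)) :=
  Finset.prod_range_succ _ _

/-- The quantum binomial coefficient with upper index `r + s` and lower index `s`. Writing it in
terms of `r` and `s` avoids truncated subtraction; it is only meaningful if `P` is not a root of
unity, so that the denominator does not vanish. -/
def quantumChoose (r s : ℕ) : k :=
  quantumFactorial P (r + s) * ((quantumFactorial P r)⁻¹ * (quantumFactorial P s)⁻¹)

variable {P}

theorem quantumFactorial_ne_zero (hP : ∀ m : ℕ, 0 < m → P ^ m ≠ 1) (n : ℕ) :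
    quantumFactorial P n ≠ 0 :=
  Finset.prod_ne_zero_iff.mpr fun i _ => sub_ne_zero.mpr (hP (i + 1) i.succ_pos).symm

theorem quantumChoose_ne_zero (hP : ∀ m : ℕ, 0 < m → P ^ m ≠ 1) (r s : ℕ) :
    quantumChoose P r s ≠ 0 :=
  mul_ne_zero (quantumFactorial_ne_zero hP _)
    (mul_ne_zero (inv_ne_zero (quantumFactorial_ne_zero hP _))
      (inv_ne_zero (quantumFactorial_ne_zero hP _)))

/-- The quantum binomial theorem for two elements with `y x = P x y`. -/
theorem add_pow_of_quantum_commute (hP : ∀ m : ℕ, 0 < m → P ^ m ≠ 1) {B : Type*} [Ring B]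
    [Algebra k B] {x y : B} (h : y * x = P • (x * y)) (n : ℕ) :
    (x + y) ^ n = ∑ i : Fin (n + 1),
      quantumChoose P (n - i) i • (x ^ (n - (i : ℕ)) * y ^ (i : ℕ)) := by
  have hF := quantumFactorial_ne_zero hP
  have hyx : ∀ r : ℕ, y * x ^ r = P ^ r • (x ^ r * y) := by
    intro r
    induction r with
    | zero => simp
    | succ r ih =>
      rw [pow_succ, ← mul_assoc, ih, smul_mul_assoc, mul_assoc, h, mul_smul_comm, smul_smul,
        ← pow_succ, mul_assoc]
  -- Dividing by the factorials makes the two halves of Pascal's rule symmetric.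
  have key : (x + y) ^ n = quantumFactorial P n • ∑ p ∈ Finset.HasAntidiagonal.antidiagonal n,
      ((quantumFactorial P p.1)⁻¹ * (quantumFactorial P p.2)⁻¹) • (x ^ p.1 * y ^ p.2) := by
    induction n with
    | zero => simp [quantumFactorial]
    | succ n ih =>
      -- `1 - P ^ (r + s) = (1 - P ^ r) + P ^ r (1 - P ^ s)`; the first summand vanishes at `r = 0`
      -- and the second at `s = 0`, which accounts for the two boundary terms.
      have hsplit : (1 - P ^ (n + 1)) • ∑ p ∈ Finset.HasAntidiagonal.antidiagonal (n + 1),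
          ((quantumFactorial P p.1)⁻¹ * (quantumFactorial P p.2)⁻¹) • (x ^ p.1 * y ^ p.2) =
          ∑ p ∈ Finset.HasAntidiagonal.antidiagonal (n + 1), ((1 - P ^ p.1) *
            ((quantumFactorial P p.1)⁻¹ * (quantumFactorial P p.2)⁻¹)) • (x ^ p.1 * y ^ p.2) +
          ∑ p ∈ Finset.HasAntidiagonal.antidiagonal (n + 1), (P ^ p.1 * (1 - P ^ p.2) *
            ((quantumFactorial P p.1)⁻¹ * (quantumFactorial P p.2)⁻¹)) • (x ^ p.1 * y ^ p.2) := by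
        rw [Finset.smul_sum, ← Finset.sum_add_distrib]
        refine Finset.sum_congr rfl fun p hp => ?_
        rw [smul_smul, ← add_smul, ← Finset.HasAntidiagonal.mem_antidiagonal.mp hp]
        congr 1
        ring
      rw [quantumFactorial_succ, mul_smul, hsplit, Finset.Nat.sum_antidiagonal_succ,
        Finset.Nat.sum_antidiagonal_succ', pow_succ', ih, mul_smul_comm, add_mul]
      simp only [pow_zero, sub_self, zero_mul, mul_zero, zero_smul, zero_add]
      congr 1
      rw [Finset.mul_sum, Finset.mul_sum]
      congr 1
      · refine Finset.sum_congr rfl fun p _ => ?_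
        have h1 := hF p.1
        have h2 := hF (p.1 + 1)
        rw [mul_smul_comm, ← mul_assoc, ← pow_succ']
        congr 1
        rw [quantumFactorial_succ] at h2 ⊢
        have h3 := right_ne_zero_of_mul h2
        field_simp
      · refine Finset.sum_congr rfl fun p _ => ?_
        have h1 := hF p.2
        have h2 := hF (p.2 + 1)
        rw [mul_smul_comm, ← mul_assoc, hyx, smul_mul_assoc, smul_smul,
          mul_assoc (x ^ p.1), ← pow_succ']
        congr 1
        rw [quantumFactorial_succ] at h2 ⊢
        have h3 := right_ne_zero_of_mul h2
        field_simp
  rw [key, ← Finset.Nat.sum_antidiagonal_swap, Finset.Nat.sum_antidiagonal_eq_sum_range_succ_mk,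
    Finset.sum_range, Finset.smul_sum]
  refine Finset.sum_congr rfl fun i _ => ?_
  rw [Prod.fst_swap, Prod.snd_swap, smul_smul, quantumChoose,
    Nat.sub_add_cancel (Nat.lt_succ_iff.mp i.2)]

end QuantumBinomial

/-! ### Matrix coefficients and invariant bilinear forms -/

section Invariance

variable {k C : Type*} [Field k] [AddCommGroup C] [Module k C] [Coalgebra k C]

/-- For a linear form `l` on a comodule `W`, the map `w ↦ ⟨l, w₍₀₎⟩ w₍₁₎` to the regular
comodule. -/
def coeffMap {W : Type*} [AddCommGroup W] [Module k W] [RightComodule k C W] (l : W →ₗ[k] k) :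
    W →ₗ[k] C :=
  (TensorProduct.lid k C).toLinearMap ∘ₗ l.rTensor C ∘ₗ RightComodule.coact

theorem coeffMap_mem_comodHom {W : Type*} [AddCommGroup W] [Module k W] [RightComodule k C W]
    (l : W →ₗ[k] k) : coeffMap l ∈ comodHom k C W C := by
  change comul ∘ₗ coeffMap l =
    (coeffMap l).rTensor C ∘ₗ RightComodule.coact (k := k) (C := C) (V := W)
  ext1 w
  have h1 : ∀ t : W ⊗[k] C, comul (R := k) (TensorProduct.lid k C (l.rTensor C t)) =
      TensorProduct.lid k _ (l.rTensor _ ((comul (R := k) (A := C)).lTensor W t)) := by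
    intro t
    induction t with
    | zero => simp
    | add x y hx hy => simp only [map_add, hx, hy]
    | tmul x y => simp
  have h2 : ∀ t : W ⊗[k] C, (coeffMap l).rTensor C t = TensorProduct.lid k _ (l.rTensor _
      (TensorProduct.assoc k W C C ((RightComodule.coact (k := k) (C := C)).rTensor C t))) := by
    intro t
    induction t with
    | zero => simp
    | add x y hx hy => simp only [map_add, hx, hy]
    | tmul x y =>
      simp only [rTensor_tmul, coeffMap, LinearMap.comp_apply, LinearEquiv.coe_coe]
      generalize RightComodule.coact (k := k) (C := C) x = s
      induction s with
      | zero => simp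
      | add u v hu hv => simp only [map_add, TensorProduct.add_tmul, hu, hv]
      | tmul u v => simp [TensorProduct.smul_tmul']
  have h3 := LinearMap.congr_fun (RightComodule.coact_coassoc (k := k) (C := C) (V := W)) w
  simp only [LinearMap.comp_apply, LinearEquiv.coe_coe] at h3 ⊢
  rw [h2, h3]
  exact h1 _

variable [CopivotalCoalgebra k C] {V W : Type*} [AddCommGroup V] [Module k V]
  [RightComodule k C V] [AddCommGroup W] [Module k W] [RightComodule k C W]
  [FiniteDimensional k V]

open RightComodule CopivotalCoalgebra

/-- On the dual comodule, evaluation at `v` has matrix coefficients `⟨f, v₍₀₎⟩ S(v₍₁₎)`. -/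
theorem coeffMap_dual_apply (v : V) (f : Dual k V) :
    coeffMap (C := C) (Dual.eval k V v) f = dualCoactAux f v := by
  rw [← dualTensorHom_dualCoact]
  change TensorProduct.lid k C ((Dual.eval k V v).rTensor C (dualCoact f)) = _
  generalize (dualCoact f : Dual k V ⊗[k] C) = s
  induction s with
  | zero => simp
  | add x y hx hy => simp only [map_add, LinearMap.add_apply, hx, hy]
  | tmul g e => simp

/-- A comodule map `f : W → V^∨`, viewed as a bilinear form, is invariant:
`⟨f(w₍₀₎), v⟩ w₍₁₎ = ⟨f(w), v₍₀₎⟩ S(v₍₁₎)`. -/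
theorem coeffMap_eq_of_mem_comodHom {f : W →ₗ[k] Dual k V} (hf : f ∈ comodHom k C W (Dual k V))
    (w : W) (v : V) : coeffMap (C := C) (f.flip v) w = dualCoactAux (f w) v := by
  have h : dualCoact (C := C) (f w) = f.rTensor C (coact w) := LinearMap.congr_fun hf w
  rw [← dualTensorHom_dualCoact, h]
  change TensorProduct.lid k C ((f.flip v).rTensor C (coact w)) = _
  generalize (coact w : W ⊗[k] C) = s
  induction s with
  | zero => simp
  | add x y hx hy => simp only [map_add, LinearMap.add_apply, hx, hy]
  | tmul g e => simp

end Invariance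

namespace OqSL2

section
variable (k : Type*) [Field k] (q : kˣ)

/-! ### Linear forms separating monomials -/

/-- The operator `f ↦ (m ↦ q ^ m f(m))` on functions on `ℤ`. -/
def scaleOp : Module.End k (ℤ → k) where
  toFun f m := (q : k) ^ m * f m
  map_add' f g := by ext m; simp [mul_add]
  map_smul' r f := by ext m; simp [mul_left_comm]

/-- The translation `f ↦ (m ↦ f(m - 1))` of functions on `ℤ`. -/
def shiftOp : Module.End k (ℤ → k) where
  toFun f m := f (m - 1)
  map_add' _ _ := rfl
  map_smul' _ _ := rfl

theorem rel_upper : QuantumSL2Rel q (scaleOp k q) (shiftOp k) 0 (scaleOp k q⁻¹) := by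
  have hq : (q : k) ≠ 0 := q.ne_zero
  constructor <;> ext f m <;> simp [scaleOp, shiftOp, zpow_sub_one₀ hq] <;> field_simp

theorem rel_lower : QuantumSL2Rel q (scaleOp k q) 0 (shiftOp k) (scaleOp k q⁻¹) := by
  have hq : (q : k) ≠ 0 := q.ne_zero
  constructor <;> ext f m <;> simp [scaleOp, shiftOp, zpow_sub_one₀ hq] <;> field_simp

/-- The `i`-th coordinate of `u · δ₀`, where `𝒪_q(SL₂)` acts on functions on `ℤ` through its
quotient by `c`. It reads off the coefficient of the monomial `a ^ r * b ^ i`, up to a power of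
`q`. -/
def upperCoeff (i : ℕ) : OqSL2 k q →ₗ[k] k :=
  LinearMap.proj (i : ℤ) ∘ₗ LinearMap.applyₗ (Pi.single (0 : ℤ) (1 : k)) ∘ₗ
    (lift (rel_upper k q)).toLinearMap

/-- The analogue of `upperCoeff` for the quotient by `b` and the monomials `a ^ r * c ^ i`. -/
def lowerCoeff (i : ℕ) : OqSL2 k q →ₗ[k] k :=
  LinearMap.proj (i : ℤ) ∘ₗ LinearMap.applyₗ (Pi.single (0 : ℤ) (1 : k)) ∘ₗ
    (lift (rel_lower k q)).toLinearMap

theorem shiftOp_pow_single (s : ℕ) :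
    (shiftOp k ^ s) (Pi.single (0 : ℤ) (1 : k)) = Pi.single (s : ℤ) 1 := by
  induction s with
  | zero => simp
  | succ s ih =>
    rw [pow_succ', Module.End.mul_apply, ih]
    ext m
    simp only [shiftOp, LinearMap.coe_mk, AddHom.coe_mk, Pi.single_apply]
    congr 1
    push_cast
    exact propext sub_eq_iff_eq_add

theorem scaleOp_pow_single (r s : ℕ) (x : k) :
    (scaleOp k q ^ r) (Pi.single (s : ℤ) x) = Pi.single (s : ℤ) ((q : k) ^ (s * r) * x) := by
  induction r with
  | zero => simp
  | succ r ih =>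
    rw [pow_succ', Module.End.mul_apply, ih]
    ext m
    simp only [scaleOp, LinearMap.coe_mk, AddHom.coe_mk, Pi.single_apply]
    split_ifs with h
    · subst h
      rw [zpow_natCast, ← mul_assoc, ← pow_add]
      ring_nf
    · simp

theorem upperCoeff_ab (i r s : ℕ) :
    upperCoeff k q i (a k q ^ r * b k q ^ s) = if i = s then (q : k) ^ (s * r) else 0 := by
  simp [upperCoeff, shiftOp_pow_single, scaleOp_pow_single, Pi.single_apply]

theorem lowerCoeff_ac (i r s : ℕ) :
    lowerCoeff k q i (a k q ^ r * c k q ^ s) = if i = s then (q : k) ^ (s * r) else 0 := by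
  simp [lowerCoeff, shiftOp_pow_single, scaleOp_pow_single, Pi.single_apply]

theorem lowerCoeff_ab {i : ℕ} (hi : i ≠ 0) (r s : ℕ) :
    lowerCoeff k q i (a k q ^ r * b k q ^ s) = 0 := by
  have h := scaleOp_pow_single k q r 0 1
  rw [Nat.cast_zero] at h
  rcases s with _ | s
  · simp [lowerCoeff, h, hi]
  · simp [lowerCoeff]

theorem lowerCoeff_cd (i r s : ℕ) :
    lowerCoeff k q i (c k q ^ s * d k q ^ r) = if i = s then 1 else 0 := by
  have h := scaleOp_pow_single k q⁻¹ r 0 1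
  rw [Nat.cast_zero, zero_mul, pow_zero, one_mul] at h
  simp [lowerCoeff, h, shiftOp_pow_single, Pi.single_apply]

/-! ### The coaction on the extreme weight vectors -/

/-- The binomial coefficient of the term with left tensor factor `a ^ (n - i) * b ^ i` in `Δ(a ^ n)`
and in `Δ(b ^ n)`. It is the same for both, since in either case the two summands of `Δ(a)`,
respectively `Δ(b)`, commute up to `q ^ 2`. -/
def comulCoeff (n i : ℕ) : k := quantumChoose (((q : k) ^ 2)⁻¹) (n - i) i

variable {k q} in
theorem inv_sq_pow_ne_one (hq : ∀ m : ℕ, 0 < m → q ^ m ≠ 1) (m : ℕ) (hm : 0 < m) :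
    (((q : k) ^ 2)⁻¹) ^ m ≠ 1 := by
  intro h
  refine hq (2 * m) (by omega) (Units.ext ?_)
  rwa [inv_pow, inv_eq_one, ← pow_mul] at h

variable {k q} in
theorem comulCoeff_ne_zero (hq : ∀ m : ℕ, 0 < m → q ^ m ≠ 1) (n i : ℕ) :
    comulCoeff k q n i ≠ 0 :=
  quantumChoose_ne_zero (inv_sq_pow_ne_one hq) _ _

/-- The spanning vectors `a ^ (n - i) * b ^ i` of `X_ℓ`. -/
def monomialX (n : ℕ) (i : Fin (n + 1)) : X k q n :=
  ⟨a k q ^ (n - (i : ℕ)) * b k q ^ (i : ℕ), Submodule.subset_span ⟨i, rfl⟩⟩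

theorem eq_sum_monomialX {n : ℕ} (v : X k q n) : ∃ r : Fin (n + 1) → k,
    v = ∑ i, r i • monomialX k q n i := by
  obtain ⟨r, hr⟩ := (Submodule.mem_span_range_iff_exists_fun k).mp v.2
  refine ⟨r, Subtype.ext ?_⟩
  rw [← hr]
  simp [monomialX]

theorem upperCoeff_monomialX {n : ℕ} (i j : Fin (n + 1)) :
    upperCoeff k q i (monomialX k q n j : OqSL2 k q) =
      if i = j then (q : k) ^ ((j : ℕ) * (n - j)) else 0 := by
  simp [monomialX, upperCoeff_ab, Fin.ext_iff]

variable {k q}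

theorem coact_eq_of_comul_eq {n : ℕ} {v : X k q n} {t : X k q n ⊗[k] OqSL2 k q}
    (h : comul (R := k) (v : OqSL2 k q) = (X k q n).subtype.rTensor _ t) :
    RightComodule.coact (k := k) (C := OqSL2 k q) v = t := by
  apply Module.Flat.rTensor_preserves_injective_linearMap (M := OqSL2 k q) _
    (X k q n).injective_subtype
  exact (subCoact_spec (X k q n) (X_coideal k q n) v).trans h

theorem coact_monomialX_zero (hq : ∀ m : ℕ, 0 < m → q ^ m ≠ 1) (n : ℕ) :
    RightComodule.coact (k := k) (C := OqSL2 k q) (monomialX k q n 0) =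
      ∑ i : Fin (n + 1), comulCoeff k q n i •
        (monomialX k q n i ⊗ₜ[k] (a k q ^ (n - (i : ℕ)) * c k q ^ (i : ℕ))) := by
  have hq0 : (q : k) ≠ 0 := q.ne_zero
  apply coact_eq_of_comul_eq
  have hcomm : (b k q ⊗ₜ[k] c k q) * (a k q ⊗ₜ[k] a k q) =
      ((q : k) ^ 2)⁻¹ • ((a k q ⊗ₜ[k] a k q) * (b k q ⊗ₜ[k] c k q)) := by
    simp only [Algebra.TensorProduct.tmul_mul_tmul, (rel k q).ab, (rel k q).ac,
      TensorProduct.tmul_smul, ← TensorProduct.smul_tmul', smul_smul]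
    rw [show ((q : k) ^ 2)⁻¹ * ((q : k) * q) = 1 by field_simp, one_smul]
  have hpow := add_pow_of_quantum_commute (inv_sq_pow_ne_one hq) hcomm n
  simp only [monomialX, Fin.val_zero, Nat.sub_zero, pow_zero, mul_one, Bialgebra.comul_pow,
    comul_a, hpow, map_sum, map_smul, rTensor_tmul, Submodule.subtype_apply,
    Algebra.TensorProduct.tmul_pow, Algebra.TensorProduct.tmul_mul_tmul, comulCoeff]

theorem coact_monomialX_last (hq : ∀ m : ℕ, 0 < m → q ^ m ≠ 1) (n : ℕ) :
    RightComodule.coact (k := k) (C := OqSL2 k q) (monomialX k q n (Fin.last n)) =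
      ∑ i : Fin (n + 1), comulCoeff k q n i •
        (monomialX k q n i ⊗ₜ[k] (b k q ^ (n - (i : ℕ)) * d k q ^ (i : ℕ))) := by
  have hq0 : (q : k) ≠ 0 := q.ne_zero
  apply coact_eq_of_comul_eq
  have hcomm : (b k q ⊗ₜ[k] d k q) * (a k q ⊗ₜ[k] b k q) =
      ((q : k) ^ 2)⁻¹ • ((a k q ⊗ₜ[k] b k q) * (b k q ⊗ₜ[k] d k q)) := by
    simp only [Algebra.TensorProduct.tmul_mul_tmul, (rel k q).ab, (rel k q).bd,
      TensorProduct.tmul_smul, ← TensorProduct.smul_tmul', smul_smul]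
    rw [show ((q : k) ^ 2)⁻¹ * ((q : k) * q) = 1 by field_simp, one_smul]
  have hpow := add_pow_of_quantum_commute (inv_sq_pow_ne_one hq) hcomm n
  simp only [monomialX, Fin.val_last, Nat.sub_self, pow_zero, one_mul, Bialgebra.comul_pow,
    comul_b, hpow, map_sum, map_smul, rTensor_tmul, Submodule.subtype_apply,
    Algebra.TensorProduct.tmul_pow, Algebra.TensorProduct.tmul_mul_tmul, comulCoeff]

theorem antipodeLin_pow (u : OqSL2 k q) (m : ℕ) :
    antipodeLin k q (u ^ m) = antipodeLin k q u ^ m := by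
  simp [antipodeLin]

theorem coeffMap_monomialX_zero (hq : ∀ m : ℕ, 0 < m → q ^ m ≠ 1) {n : ℕ} (l : X k q n →ₗ[k] k) :
    coeffMap (C := OqSL2 k q) l (monomialX k q n 0) = ∑ i : Fin (n + 1),
      (comulCoeff k q n i * l (monomialX k q n i)) • (a k q ^ (n - (i : ℕ)) * c k q ^ (i : ℕ)) := by
  simp [coeffMap, coact_monomialX_zero hq, smul_smul]

theorem dualCoactAux_monomialX_zero (hq : ∀ m : ℕ, 0 < m → q ^ m ≠ 1) {n : ℕ}
    (l : Dual k (X k q n)) :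
    dualCoactAux (C := OqSL2 k q) l (monomialX k q n 0) = ∑ i : Fin (n + 1),
      (comulCoeff k q n i * l (monomialX k q n i) * (-(q : k)) ^ (i : ℕ)) •
        (c k q ^ (i : ℕ) * d k q ^ (n - (i : ℕ))) := by
  have hS : (CopivotalCoalgebra.S (k := k) (C := OqSL2 k q)) = antipodeLin k q := rfl
  simp only [dualCoactAux, LinearMap.coe_mk, AddHom.coe_mk, LinearMap.comp_apply,
    LinearEquiv.coe_coe, coact_monomialX_zero hq, map_sum, map_smul, TensorProduct.map_tmul,
    TensorProduct.lid_tmul, hS, antipodeLin_mul, antipodeLin_pow, antipodeLin_a, antipodeLin_c,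
    smul_pow, smul_mul_assoc, smul_smul, mul_assoc]

theorem dualCoactAux_monomialX_last (hq : ∀ m : ℕ, 0 < m → q ^ m ≠ 1) {n : ℕ}
    (l : Dual k (X k q n)) :
    dualCoactAux (C := OqSL2 k q) l (monomialX k q n (Fin.last n)) = ∑ i : Fin (n + 1),
      (comulCoeff k q n i * l (monomialX k q n i) * (-(q : k)⁻¹) ^ (n - (i : ℕ))) •
        (a k q ^ (i : ℕ) * b k q ^ (n - (i : ℕ))) := by
  have hS : (CopivotalCoalgebra.S (k := k) (C := OqSL2 k q)) = antipodeLin k q := rfl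
  simp only [dualCoactAux, LinearMap.coe_mk, AddHom.coe_mk, LinearMap.comp_apply,
    LinearEquiv.coe_coe, coact_monomialX_last hq, map_sum, map_smul, TensorProduct.map_tmul,
    TensorProduct.lid_tmul, hS, antipodeLin_mul, antipodeLin_pow, antipodeLin_d, antipodeLin_b,
    smul_pow, mul_smul_comm, smul_smul, mul_assoc]

/-! ### Comodule maps from `X_ℓ` to its dual -/

/-- The matrix coefficients of `X_ℓ^∨` at `b ^ n` are faithful: up to nonzero scalars they are the
monomials `a ^ i * b ^ (n - i)`. -/
theorem dualCoactAux_monomialX_last_eq_zero (hq : ∀ m : ℕ, 0 < m → q ^ m ≠ 1) {n : ℕ}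
    {l : Dual k (X k q n)}
    (h : dualCoactAux (C := OqSL2 k q) l (monomialX k q n (Fin.last n)) = 0) : l = 0 := by
  have hq0 : (q : k) ≠ 0 := q.ne_zero
  have hl : ∀ i : Fin (n + 1), l (monomialX k q n i) = 0 := by
    intro i
    have h1 := congrArg (upperCoeff k q (n - i)) h
    rw [dualCoactAux_monomialX_last hq, map_sum, map_zero, Finset.sum_eq_single i] at h1
    · simpa [upperCoeff_ab, comulCoeff_ne_zero hq, hq0] using h1
    · intro j _ hj
      have : n - (i : ℕ) ≠ n - (j : ℕ) := by
        have := Fin.val_ne_of_ne hj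
        omega
      simp [upperCoeff_ab, this]
    · simp
  ext1 v
  obtain ⟨r, rfl⟩ := eq_sum_monomialX k q v
  simp [hl]

/-- A comodule map `X_ℓ → X_ℓ^∨` is determined by its value `⟨f(a ^ n), b ^ n⟩`. -/
theorem eq_zero_of_apply_zero_last (hq : ∀ m : ℕ, 0 < m → q ^ m ≠ 1) {n : ℕ}
    {f : X k q n →ₗ[k] Dual k (X k q n)}
    (hf : f ∈ comodHom k (OqSL2 k q) (X k q n) (Dual k (X k q n)))
    (h0 : f (monomialX k q n 0) (monomialX k q n (Fin.last n)) = 0) : f = 0 := by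
  have hq0 : (q : k) ≠ 0 := q.ne_zero
  -- Invariance equates a combination of the `a ^ (n - i) * c ^ i` with one of the
  -- `a ^ j * b ^ (n - j)`, and only `a ^ n` is common to the two families.
  have hflip : f.flip (monomialX k q n (Fin.last n)) = 0 := by
    have hm : ∀ i : Fin (n + 1), f (monomialX k q n i) (monomialX k q n (Fin.last n)) = 0 := by
      intro i
      rcases eq_or_ne i 0 with rfl | hi
      · exact h0
      have hi' : (i : ℕ) ≠ 0 := fun h => hi (Fin.ext h)
      have h1 := congrArg (lowerCoeff k q i) (coeffMap_eq_of_mem_comodHom hf (monomialX k q n 0)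
        (monomialX k q n (Fin.last n)))
      rw [coeffMap_monomialX_zero hq, dualCoactAux_monomialX_last hq, map_sum, map_sum,
        Finset.sum_eq_single i] at h1
      · simpa [lowerCoeff_ac, lowerCoeff_ab k q hi', comulCoeff_ne_zero hq, hq0] using h1
      · intro j _ hj
        have : (i : ℕ) ≠ j := (Fin.val_ne_of_ne hj).symm
        simp [lowerCoeff_ac, this]
      · simp
    ext1 v
    obtain ⟨r, rfl⟩ := eq_sum_monomialX k q v
    simp [hm]
  refine LinearMap.ext fun v => ?_
  apply dualCoactAux_monomialX_last_eq_zero hq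
  rw [← coeffMap_eq_of_mem_comodHom hf, hflip]
  simp [coeffMap]

/-- An invariant form is symmetric up to the factor `(-q) ^ n` on the extreme weight vectors: compare
the coefficients of `c ^ n` in the invariance identity at the pair `a ^ n`, `a ^ n`. -/
theorem apply_last_zero (hq : ∀ m : ℕ, 0 < m → q ^ m ≠ 1) {n : ℕ}
    {f : X k q n →ₗ[k] Dual k (X k q n)}
    (hf : f ∈ comodHom k (OqSL2 k q) (X k q n) (Dual k (X k q n))) :
    f (monomialX k q n (Fin.last n)) (monomialX k q n 0) =
      (-(q : k)) ^ n * f (monomialX k q n 0) (monomialX k q n (Fin.last n)) := by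
  have h1 := congrArg (lowerCoeff k q n) (coeffMap_eq_of_mem_comodHom hf (monomialX k q n 0)
    (monomialX k q n 0))
  rw [coeffMap_monomialX_zero hq, dualCoactAux_monomialX_zero hq, map_sum, map_sum,
    Finset.sum_eq_single (Fin.last n), Finset.sum_eq_single (Fin.last n)] at h1
  · rw [map_smul, map_smul, lowerCoeff_ac, lowerCoeff_cd] at h1
    simp only [Fin.val_last, if_true, smul_eq_mul, Nat.sub_self, mul_zero, pow_zero, mul_one,
      LinearMap.flip_apply] at h1
    apply mul_left_cancel₀ (comulCoeff_ne_zero hq n n)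
    rw [h1]
    ring
  · intro j _ hj
    have : n ≠ (j : ℕ) := fun h => hj (Fin.ext h.symm)
    simp [lowerCoeff_cd, this]
  · simp
  · intro j _ hj
    have : n ≠ (j : ℕ) := fun h => hj (Fin.ext h.symm)
    simp [lowerCoeff_ac, this]
  · simp

/-- Transposition is the scalar `(-1) ^ n`: the factor `(-q) ^ n` of `apply_last_zero` is multiplied by
`γ(a) ^ n = q⁻¹ ^ n`. -/
theorem transposition_eq (hq : ∀ m : ℕ, 0 < m → q ^ m ≠ 1) (n : ℕ) :
    transposition k (OqSL2 k q) (X k q n) (X k q n) = (-1 : k) ^ n • LinearMap.id := by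
  have hq0 : (q : k) ≠ 0 := q.ne_zero
  ext1 f
  have hmem := Submodule.add_mem _ (transposition k (OqSL2 k q) (X k q n) (X k q n) f).2
    (Submodule.smul_mem _ (-(-1 : k) ^ n) f.2)
  suffices h : (transposition k (OqSL2 k q) (X k q n) (X k q n) f).1 + (-(-1 : k) ^ n) • f.1 = 0 by
    refine Subtype.ext (LinearMap.ext fun v => LinearMap.ext fun w => ?_)
    have h1 := LinearMap.congr_fun (LinearMap.congr_fun h v) w
    simp only [LinearMap.add_apply, LinearMap.smul_apply, LinearMap.zero_apply, smul_eq_mul,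
      neg_mul, add_neg_eq_zero] at h1
    exact h1
  refine eq_zero_of_apply_zero_last hq hmem ?_
  have hact : dualAct (CopivotalCoalgebra.γ (k := k) (C := OqSL2 k q)) (monomialX k q n 0) =
      (q : k)⁻¹ ^ n • monomialX k q n 0 := by
    have hγ : (CopivotalCoalgebra.γ (k := k) (C := OqSL2 k q)) = (gamma k q).toLinearMap := rfl
    simp only [dualAct, LinearMap.comp_apply, coact_monomialX_zero hq, hγ, map_sum, map_smul,
      lTensor_tmul, LinearEquiv.coe_coe, TensorProduct.rid_tmul, AlgHom.toLinearMap_apply, map_mul,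
      map_pow, gamma_a, gamma_c]
    rw [Finset.sum_eq_single 0]
    · simp [comulCoeff, quantumChoose, quantumFactorial_zero,
        quantumFactorial_ne_zero (inv_sq_pow_ne_one hq)]
    · intro i _ hi
      have hi' : (i : ℕ) ≠ 0 := fun h => hi (Fin.ext h)
      simp [hi']
    · simp
  have h1 : (transposition k (OqSL2 k q) (X k q n) (X k q n) f).1 (monomialX k q n 0)
      (monomialX k q n (Fin.last n)) =
      f.1 (monomialX k q n (Fin.last n)) ((q : k)⁻¹ ^ n • monomialX k q n 0) := by
    rw [← hact]
    rfl
  simp only [LinearMap.add_apply, h1, LinearMap.smul_apply, map_smul, apply_last_zero hq f.2,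
    smul_eq_mul]
  rw [← mul_assoc, ← mul_pow, ← add_mul]
  simp [hq0]

/-- There is a nonzero comodule map `X_ℓ → X_ℓ^∨`: the matrix coefficients of `X_ℓ^∨` at `b ^ n` are
the monomials spanning `X_ℓ`, so they define an isomorphism `X_ℓ^∨ → X_ℓ`. -/
theorem exists_comodHom_dual_ne_zero (hq : ∀ m : ℕ, 0 < m → q ^ m ≠ 1) (n : ℕ) :
    ∃ f ∈ comodHom k (OqSL2 k q) (X k q n) (Dual k (X k q n)), f ≠ 0 := by
  have hq0 : (q : k) ≠ 0 := q.ne_zero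
  set l : Dual k (X k q n) →ₗ[k] k := Dual.eval k _ (monomialX k q n (Fin.last n)) with hl
  have hmem : ∀ f, coeffMap (C := OqSL2 k q) l f ∈ X k q n := by
    intro f
    rw [hl, coeffMap_dual_apply, dualCoactAux_monomialX_last hq]
    refine Submodule.sum_mem _ fun i _ => Submodule.smul_mem _ _ ?_
    have := mem_X k q i (n - i)
    rwa [Nat.add_sub_cancel' (Nat.lt_succ_iff.mp i.2)] at this
  let Φ : Dual k (X k q n) →ₗ[k] X k q n := (coeffMap (C := OqSL2 k q) l).codRestrict _ hmem
  have hinj : Function.Injective Φ := by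
    rw [← LinearMap.ker_eq_bot, LinearMap.ker_eq_bot']
    intro f hf
    apply dualCoactAux_monomialX_last_eq_zero hq
    rw [← coeffMap_dual_apply]
    exact congrArg Subtype.val hf
  let e : Dual k (X k q n) ≃ₗ[k] X k q n :=
    LinearEquiv.ofInjectiveOfFinrankEq Φ hinj Subspace.dual_finrank_eq
  have heΦ : e.toLinearMap = Φ := by ext; rfl
  have hΦ : RightComodule.coact (C := OqSL2 k q) ∘ₗ Φ =
      Φ.rTensor _ ∘ₗ RightComodule.coact (k := k) (C := OqSL2 k q) := by
    ext1 f
    apply coact_eq_of_comul_eq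
    have h1 : comul (coeffMap (C := OqSL2 k q) l f) = (coeffMap (C := OqSL2 k q) l).rTensor _
        (RightComodule.coact (k := k) (C := OqSL2 k q) f) :=
      LinearMap.congr_fun (coeffMap_mem_comodHom (C := OqSL2 k q) l) f
    refine h1.trans ?_
    rw [LinearMap.comp_apply, ← LinearMap.rTensor_comp_apply, LinearMap.subtype_comp_codRestrict]
  refine ⟨e.symm.toLinearMap, ?_, ?_⟩
  · change RightComodule.coact (C := OqSL2 k q) ∘ₗ e.symm.toLinearMap =
      e.symm.toLinearMap.rTensor _ ∘ₗ RightComodule.coact (k := k) (C := OqSL2 k q)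
    have h2 : e.symm.toLinearMap ∘ₗ Φ = LinearMap.id := by rw [← heΦ]; ext1; simp
    have h3 : Φ ∘ₗ e.symm.toLinearMap = LinearMap.id := by rw [← heΦ]; ext1; simp
    calc RightComodule.coact (C := OqSL2 k q) ∘ₗ e.symm.toLinearMap
        = (e.symm.toLinearMap ∘ₗ Φ).rTensor _ ∘ₗ
            RightComodule.coact (C := OqSL2 k q) ∘ₗ e.symm.toLinearMap := by
          rw [h2, LinearMap.rTensor_id, LinearMap.id_comp]
      _ = e.symm.toLinearMap.rTensor _ ∘ₗ (RightComodule.coact (C := OqSL2 k q) ∘ₗ Φ) ∘ₗ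
            e.symm.toLinearMap := by
          rw [hΦ, LinearMap.rTensor_comp]
          simp only [LinearMap.comp_assoc]
      _ = _ := by rw [LinearMap.comp_assoc, h3, LinearMap.comp_id]
  · intro h
    have h4 : monomialX k q n 0 = 0 := by
      have := LinearMap.congr_fun h (monomialX k q n 0)
      simpa using this
    have h5 := upperCoeff_monomialX k q (0 : Fin (n + 1)) 0
    simp [h4] at h5

theorem finrank_comodHom_dual (hq : ∀ m : ℕ, 0 < m → q ^ m ≠ 1) (n : ℕ) :
    Module.finrank k (comodHom k (OqSL2 k q) (X k q n) (Dual k (X k q n))) = 1 := by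
  -- Instance search finds only the additive monoid structure on this submodule.
  let _ : AddCommGroup (comodHom k (OqSL2 k q) (X k q n) (Dual k (X k q n))) :=
    Module.addCommMonoidToAddCommGroup k
  let E : comodHom k (OqSL2 k q) (X k q n) (Dual k (X k q n)) →ₗ[k] k :=
    LinearMap.applyₗ (monomialX k q n (Fin.last n)) ∘ₗ LinearMap.applyₗ (monomialX k q n 0) ∘ₗ
      Submodule.subtype _
  have hE : Function.Injective E := by
    rw [← LinearMap.ker_eq_bot, LinearMap.ker_eq_bot']
    exact fun f hf => Subtype.ext (eq_zero_of_apply_zero_last hq f.2 hf)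
  refine le_antisymm ((LinearMap.finrank_le_finrank_of_injective hE).trans_eq
    (Module.finrank_self k)) ?_
  obtain ⟨f, hf, hf0⟩ := exists_comodHom_dual_ne_zero hq n
  exact Module.finrank_pos_iff_exists_ne_zero.mpr ⟨⟨f, hf⟩, fun h => hf0 (congrArg Subtype.val h)⟩

end

end OqSL2

end

end

theorem theorem5p1 {k : Type*} [Field k] [IsAlgClosed k] [CharZero k] (q : kˣ)
    (hq : ∀ m : ℕ, 0 < m → q ^ m ≠ 1) (n : ℕ) :
    fsIndicator k (OqSL2 k q) (OqSL2.X k q n) = (-1 : k) ^ n := by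
  -- Instance search finds only the additive monoid structure on this submodule.
  let _ : AddCommGroup (comodHom k (OqSL2 k q) (OqSL2.X k q n) (Module.Dual k (OqSL2.X k q n))) :=
    Module.addCommMonoidToAddCommGroup k
  rw [fsIndicator, OqSL2.transposition_eq hq, map_smul, LinearMap.trace_id,
    OqSL2.finrank_comodHom_dual hq, Nat.cast_one, smul_eq_mul, mul_one]
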